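/- **Setting.** Let $\nu\in C^\infty(\mathbb R)$ be real-valued with $\nu(x)+\nu(1-x)=1$ for all $x$, $\nu=0$ on $(-\infty,0]$ and $\nu=1$ on $[1,\infty)$, and let $a,b\in\mathbb R$. Define $$W(\xi)=\begin{cases}e^{-\pi i a\xi}\sin\!\big[\tfrac{\pi}{2}\nu(16|\xi|-1)\big],&\tfrac1{16}\le|\xi|\le\tfrac18,\\ e^{-\pi i b\xi}\cos\!\big[\tfrac{\pi}{2}\nu(8|\xi|-1)\big],&\tfrac18<|\xi|\le\tfrac14,\\0,&\text{else},\end{cases}\qquad \hat\phi(\xi)=\begin{cases}1,&|\xi|\le\tfrac1{16},\\ \cos\!\big[\tfrac{\pi}{2}\nu(16|\xi|-1)\big],&\tfrac1{16}<|\xi|\le\tfrac18,\\0,&\text{else}\end{cases}$$ (for $a=b=16/3$ this is the smooth Meyer generator), and $W^h(\xi)=W(\xi_1)\hat\phi(\xi_2)$, $W^v(\xi)=\hat\phi(\xi_1)W(\xi_2)$, $W^d(\xi)=W(\xi_1)W(\xi_2)$. With $\hat f(\xi)=\int f(x)e^{-2\pi i\langle x,\xi\rangle}dx$, the 2D Meyer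 Parseval system $\Phi=\{\psi_\lambda\}$ of $L^2(\mathbb R^2)$ is given by $$\hat\psi_\lambda(\xi)=2^{-j}W^\iota(\xi/2^j)e^{-2\pi i\langle k,\xi/2^j\rangle},\qquad \lambda=(\iota,j,k)\in\{h,v,d\}\times\mathbb Z\times\mathbb Z^2 .$$ Let $\rho>0$ and let $w:\mathbb R\to[0,1]$ be smooth, supported in $[-\rho,\rho]$ and not identically zero; let $\langle w\mathcal L,g\rangle=\int_{-\rho}^{\rho}w(x_1)g(x_1,0)\,dx_1$. For $j\ge 0$ put $F_j(\xi)=\sum_{\iota\in\{h,v,d\}}\big(W^\iota(2^{-2j}\xi)+W^\iota(2^{-2j-1}\xi)\big)$ and let $w\mathcal L_j=w\mathcal L\star\check F_j$, that is, $w\mathcal L_j(x)=\int_{-\rho}^{\rho}w(t)\,\check F_j(x_1-t,x_2)\,dt$, where $\check F_j$ is the inverse Fourier transform of $F_j$. For $h_j\ge0$ the data in the strip $\{|x_1|\le h_j\}$ are missing: only $f_j=\mathbb 1_{\{|x_1|>h_j\}}\,w\mathcal L_j$ is known. For a threshold $\beta_j>0$ let $\mathcal T_j=\{\lambda:|\langle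 f_j,\psi_\lambda\rangle|\ge\beta_j\}$. **Theorem.** Let $h_j=o(2^{-2j})$ as $j\to\infty$, and let $(\beta_j)_{j\ge 0}$ be any sequence of positive thresholds with $\beta_j\to0$. Then $w\mathcal L_j\in L^2(\mathbb R^2)$ for every $j$, $w\mathcal L_j\ne0$ for all large $j$, and the one-step hard thresholding reconstruction $$L_j=\Phi\mathbb 1_{\mathcal T_j}\Phi^*f_j=\sum_{\lambda\in\mathcal T_j}\langle f_j,\psi_\lambda\rangle\psi_\lambda$$ (the sum converging unconditionally in $L^2(\mathbb R^2)$) satisfies $$\frac{\|L_j-w\mathcal L_j\|_2}{\|w\mathcal L_j\|_2}\to0,\qquad j\to\infty .$$ The same holds for $L_j=\Phi\mathbb 1_{\mathcal T_j}\Phi^* w\mathcal L_j$, with the same sets $\mathcal T_j$. -/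

import Mathlib

open MeasureTheory Filter Topology Asymptotics FourierTransform
open scoped ContDiff ENNReal

noncomputable section

/-! ## One-step hard thresholding in a Hilbert space -/

section Abstract

variable {H : Type*} [NormedAddCommGroup H] [InnerProductSpace ℂ H] {I : Type*}

/-- The set `{i : |⟨y, φ_i⟩| ≥ β}` of significant coefficients of `y`. -/
def thresholdSet (Φ : I → H) (y : H) (β : ℝ) : Set I :=
  {i | β ≤ ‖inner ℂ (Φ i) y‖}

/-- `x = Φ 𝟙_T Φ* z` : the (unconditionally convergent) sum of `⟨z, φ_i⟩ φ_i` over `i ∈ T` is `x`.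
Mathlib's inner product is conjugate-linear in its first argument, so `⟨z, φ_i⟩` is
`inner ℂ (Φ i) z`. -/
def IsPartialReconstruction (Φ : I → H) (T : Set I) (z x : H) : Prop :=
  HasSum (fun i : T => inner ℂ (Φ (i : I)) z • Φ (i : I)) x

end Abstract

/-! ## The 2D Meyer system -/

/-- The Euclidean plane. -/
abbrev Plane := EuclideanSpace ℝ (Fin 2)

/-- The space `L²(ℝ²)` of complex functions. -/
abbrev L2Plane := Lp ℂ 2 (volume : Measure Plane)

/-- The smooth auxiliary functions `ν` of the Meyer construction. -/
structure MeyerTransition where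
  toFun : ℝ → ℝ
  smooth : ContDiff ℝ ∞ toFun
  add_reflect : ∀ x, toFun x + toFun (1 - x) = 1
  eq_zero : ∀ x, x ≤ 0 → toFun x = 0
  eq_one : ∀ x, 1 ≤ x → toFun x = 1

/-- The Fourier transform `W` of the 1D Meyer generator, with phase factors `exp (-iπaξ)` on the
inner and `exp (-iπbξ)` on the outer band. -/
def meyerW (ν : MeyerTransition) (a b : ℝ) (ξ : ℝ) : ℂ :=
  if 1 / 16 ≤ |ξ| ∧ |ξ| ≤ 1 / 8 then
    Complex.exp (-(Real.pi * a * ξ : ℝ) * Complex.I) *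
      (Real.sin (Real.pi / 2 * ν.toFun (16 * |ξ| - 1)) : ℂ)
  else if 1 / 8 ≤ |ξ| ∧ |ξ| ≤ 1 / 4 then
    Complex.exp (-(Real.pi * b * ξ : ℝ) * Complex.I) *
      (Real.cos (Real.pi / 2 * ν.toFun (8 * |ξ| - 1)) : ℂ)
  else 0

/-- The Fourier transform of the 1D Meyer scaling function. -/
def meyerPhiHat (ν : MeyerTransition) (ξ : ℝ) : ℂ :=
  if |ξ| ≤ 1 / 16 then 1
  else if 1 / 16 ≤ |ξ| ∧ |ξ| ≤ 1 / 8 then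
    (Real.cos (Real.pi / 2 * ν.toFun (16 * |ξ| - 1)) : ℂ)
  else 0

/-- The three types of 2D wavelets: horizontal, vertical, diagonal. -/
inductive WaveletType where
  | h
  | v
  | d

/-- The functions `W^h`, `W^v`, `W^d` on the frequency plane. -/
def meyerW2 (ν : MeyerTransition) (a b : ℝ) : WaveletType → Plane → ℂ
  | .h, ξ => meyerW ν a b (ξ 0) * meyerPhiHat ν (ξ 1)
  | .v, ξ => meyerPhiHat ν (ξ 0) * meyerW ν a b (ξ 1)
  | .d, ξ => meyerW ν a b (ξ 0) * meyerW ν a b (ξ 1)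

/-- The indices `λ = (ι, j, k)`. -/
structure MeyerIndex where
  type : WaveletType
  scale : ℤ
  pos : Fin 2 → ℤ

/-- `ψ̂_λ(ξ) = 2^{-j} W^ι(ξ / 2^j) exp (-2πi ⟨k, ξ / 2^j⟩)`. -/
def meyerHat (ν : MeyerTransition) (a b : ℝ) (l : MeyerIndex) (ξ : Plane) : ℂ :=
  (2 : ℂ) ^ (-l.scale) * meyerW2 ν a b l.type ((2 : ℝ) ^ (-l.scale) • ξ) *
    Complex.exp (-(2 * Real.pi *
      ((2 : ℝ) ^ (-l.scale) * (l.pos 0 * ξ 0 + l.pos 1 * ξ 1)) : ℝ) * Complex.I)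

/-! The functions `ψ̂_λ` are square integrable (they are bounded with compact support). -/

theorem measurable_meyerW (ν : MeyerTransition) (a b : ℝ) : Measurable (meyerW ν a b) := by
  have hν : Continuous ν.toFun := ν.smooth.continuous
  unfold meyerW
  refine Measurable.ite ?_ ?_ (Measurable.ite ?_ ?_ measurable_const)
  · exact (measurableSet_le measurable_const continuous_abs.measurable).inter
      (measurableSet_le continuous_abs.measurable measurable_const)
  · exact Continuous.measurable (by fun_prop)
  · exact (measurableSet_le measurable_const continuous_abs.measurable).inter
      (measurableSet_le continuous_abs.measurable measurable_const)
  · exact Continuous.measurable (by fun_prop)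

theorem measurable_meyerPhiHat (ν : MeyerTransition) : Measurable (meyerPhiHat ν) := by
  have hν : Continuous ν.toFun := ν.smooth.continuous
  unfold meyerPhiHat
  refine Measurable.ite ?_ measurable_const (Measurable.ite ?_ ?_ measurable_const)
  · exact measurableSet_le continuous_abs.measurable measurable_const
  · exact (measurableSet_le measurable_const continuous_abs.measurable).inter
      (measurableSet_le continuous_abs.measurable measurable_const)
  · exact Continuous.measurable (by fun_prop)

theorem norm_meyerW_le (ν : MeyerTransition) (a b ξ : ℝ) : ‖meyerW ν a b ξ‖ ≤ 1 := by
  unfold meyerW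
  split_ifs
  · rw [norm_mul, ← Complex.ofReal_neg, Complex.norm_exp_ofReal_mul_I, one_mul, Complex.norm_real]
    exact Real.abs_sin_le_one _
  · rw [norm_mul, ← Complex.ofReal_neg, Complex.norm_exp_ofReal_mul_I, one_mul, Complex.norm_real]
    exact Real.abs_cos_le_one _
  · simp

theorem norm_meyerPhiHat_le (ν : MeyerTransition) (ξ : ℝ) : ‖meyerPhiHat ν ξ‖ ≤ 1 := by
  unfold meyerPhiHat
  split_ifs
  · simp
  · rw [Complex.norm_real]
    exact Real.abs_cos_le_one _
  · simp

theorem meyerW_eq_zero (ν : MeyerTransition) (a b ξ : ℝ) (h : 1 / 4 < |ξ|) :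
    meyerW ν a b ξ = 0 := by
  unfold meyerW
  rw [if_neg (by rintro ⟨_, h2⟩; linarith), if_neg (by rintro ⟨_, h2⟩; linarith)]

theorem meyerPhiHat_eq_zero (ν : MeyerTransition) (ξ : ℝ) (h : 1 / 4 < |ξ|) :
    meyerPhiHat ν ξ = 0 := by
  unfold meyerPhiHat
  rw [if_neg (by linarith), if_neg (by rintro ⟨_, h2⟩; linarith)]

theorem measurable_meyerW2 (ν : MeyerTransition) (a b : ℝ) (t : WaveletType) :
    Measurable (meyerW2 ν a b t) := by
  have h1 := measurable_meyerW ν a b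
  have h2 := measurable_meyerPhiHat ν
  have e0 : Measurable fun ξ : Plane => ξ 0 := Continuous.measurable (by fun_prop)
  have e1 : Measurable fun ξ : Plane => ξ 1 := Continuous.measurable (by fun_prop)
  cases t
  · exact (h1.comp e0).mul (h2.comp e1)
  · exact (h2.comp e0).mul (h1.comp e1)
  · exact (h1.comp e0).mul (h1.comp e1)

theorem norm_meyerW2_le (ν : MeyerTransition) (a b : ℝ) (t : WaveletType) (ξ : Plane) :
    ‖meyerW2 ν a b t ξ‖ ≤ 1 := by
  have h1 := norm_meyerW_le ν a b
  have h2 := norm_meyerPhiHat_le ν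
  cases t <;> simp only [meyerW2, norm_mul] <;>
    exact mul_le_one₀ (by first | exact h1 _ | exact h2 _) (norm_nonneg _)
      (by first | exact h1 _ | exact h2 _)

theorem meyerW2_eq_zero (ν : MeyerTransition) (a b : ℝ) (t : WaveletType) (ξ : Plane)
    (h : 1 < ‖ξ‖) : meyerW2 ν a b t ξ = 0 := by
  have h1 := meyerW_eq_zero ν a b
  have h2 := meyerPhiHat_eq_zero ν
  have key : 1 / 4 < |ξ 0| ∨ 1 / 4 < |ξ 1| := by
    by_contra hc
    push Not at hc
    have hn : ‖ξ‖ ^ 2 = |ξ 0| ^ 2 + |ξ 1| ^ 2 := by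
      rw [EuclideanSpace.norm_sq_eq]; simp [Fin.sum_univ_two]
    nlinarith [abs_nonneg (ξ 0), abs_nonneg (ξ 1), hc.1, hc.2]
  cases t <;> simp only [meyerW2] <;> rcases key with k | k <;> simp [h1 _ k, h2 _ k]

theorem memLp_meyerHat (ν : MeyerTransition) (a b : ℝ) (l : MeyerIndex) :
    MemLp (meyerHat ν a b l) 2 (volume : Measure Plane) := by
  have hm : Measurable (meyerHat ν a b l) := by
    unfold meyerHat
    refine Measurable.mul (Measurable.mul measurable_const
      ((measurable_meyerW2 ν a b l.type).comp (measurable_const_smul _))) ?_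
    exact Continuous.measurable (by fun_prop)
  have hb : ∀ ξ, ‖meyerHat ν a b l ξ‖ ≤ ‖(2 : ℂ) ^ (-l.scale)‖ := by
    intro ξ
    unfold meyerHat
    rw [norm_mul, ← Complex.ofReal_neg, Complex.norm_exp_ofReal_mul_I, mul_one, norm_mul]
    exact mul_le_of_le_one_right (norm_nonneg _) (norm_meyerW2_le ν a b _ _)
  refine (memLp_top_of_bound hm.aestronglyMeasurable _
    (Eventually.of_forall hb)).mono_exponent_of_measure_support_ne_top
      (s := Metric.closedBall (0 : Plane) ((2 : ℝ) ^ l.scale)) ?_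
      measure_closedBall_lt_top.ne le_top
  intro ξ hξ
  rw [mem_closedBall_zero_iff, not_le] at hξ
  unfold meyerHat
  rw [meyerW2_eq_zero ν a b l.type, mul_zero, zero_mul]
  have hp : (0 : ℝ) < 2 ^ l.scale := by positivity
  rw [norm_smul, zpow_neg, norm_inv, Real.norm_of_nonneg hp.le]
  rw [lt_inv_mul_iff₀ hp]
  simpa using hξ

/-- The Meyer system `(ψ_λ)` in `L²(ℝ²)`: the inverse Fourier transforms of the `ψ̂_λ`. -/
def meyerWavelet (ν : MeyerTransition) (a b : ℝ) (l : MeyerIndex) : L2Plane :=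
  𝓕⁻ ((memLp_meyerHat ν a b l).toLp (meyerHat ν a b l))

/-! ## The image model and the mask -/

/-- The frequency filter `F_j(ξ) = ∑_ι (W^ι(2^{-2j} ξ) + W^ι(2^{-2j-1} ξ))`. -/
def meyerFilter (ν : MeyerTransition) (a b : ℝ) (j : ℕ) (ξ : Plane) : ℂ :=
  let s : ℝ := (2 : ℝ) ^ (-(2 * (j : ℤ)))
  let s' : ℝ := (2 : ℝ) ^ (-(2 * (j : ℤ)) - 1)
  (meyerW2 ν a b .h (s • ξ) + meyerW2 ν a b .h (s' • ξ)) +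
  (meyerW2 ν a b .v (s • ξ) + meyerW2 ν a b .v (s' • ξ)) +
  (meyerW2 ν a b .d (s • ξ) + meyerW2 ν a b .d (s' • ξ))

/-- The action `⟨wL, g⟩ = ∫_{-ρ}^{ρ} w(t) g(t, 0) dt` of the weighted line singularity. -/
def lineSingularity (w : ℝ → ℝ) (ρ : ℝ) (g : Plane → ℂ) : ℂ :=
  ∫ t in (-ρ)..ρ, (w t : ℂ) * g !₂[t, 0]

/-- The filtered line singularity `wL_j = wL ⋆ F̌_j`, i.e. `x ↦ ⟨wL, F̌_j(x - ·)⟩`. -/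
def filteredLine (ν : MeyerTransition) (a b : ℝ) (w : ℝ → ℝ) (ρ : ℝ) (j : ℕ) (x : Plane) : ℂ :=
  lineSingularity w ρ fun t => 𝓕⁻ (meyerFilter ν a b j) (x - t)

/-- The vertical strip `{|x₁| ≤ h}` of missing data. -/
def maskStrip (h : ℝ) : Set Plane := {x | |x 0| ≤ h}

theorem measurableSet_maskStrip (h : ℝ) : MeasurableSet (maskStrip h) :=
  (isClosed_le (by fun_prop : Continuous fun x : Plane => |x 0|) continuous_const).measurableSet

/-- The projection of `L²(ℝ²)` onto the known part: multiplication by the indicator function of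
the complement of the strip. -/
def knownPart (h : ℝ) (f : L2Plane) : L2Plane :=
  ((Lp.memLp f).indicator (measurableSet_maskStrip h).compl).toLp
    ((maskStrip h)ᶜ.indicator f)

end

/-! The argument rests on two facts: the Meyer system is a Parseval frame, and the filtered line is,
up to small relative error, a separable function whose frame coefficients are explicit.

For a Parseval frame with analysis operator A, let x be the image, f the known part, y an
approximation of x, and z = f or z = x. With T the threshold set of f, the error is A*(1_T A(z - x))
- A*(1_{Tᶜ} A x). The first term is at most ‖x - f‖. In the second, A x may be replaced by A f at
the cost ‖x - f‖. Off T the coefficients of f lie below β, so each is at most min(|⟨y, φ_i⟩|, β) +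
|⟨f - y, φ_i⟩|. Hence (`IsParsevalFrame.norm_reconstruction_sub_le`) only ‖x - f‖, ‖x - y‖ and the
clipped energy ∑ min(|⟨y, φ_i⟩|, β)² matter, and each has to be o(2^j) in norm, because ‖wL_j‖ is
bounded below by a multiple of 2^j.

The Fourier transform of wL_j is ŵ(ξ₁) F_j(ξ) (`filteredLine_eq_fourierInv`). Approximate ŵ in L² by
a compactly supported smooth g. On the support of g and for large j, F_j depends on ξ₂ only and
equals the profile p(2^{-2j} ξ₂). So y_j has Fourier transform g(ξ₁) p(2^{-2j} ξ₂), and ‖y_j‖ = 2^j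
‖g‖ ‖p‖. Three estimates follow: the approximation error is at most 6 · 2^j ‖ŵ - g‖
(`norm_filter_sub_lineApprox_le`); the energy of y_j in the strip is O(h_j 2^{2j}), since 𝓕⁻ g is
bounded (`norm_strip_lineApprox_le`); only vertical wavelets at the four scales 2j - 1, ..., 2j + 2
see y_j, with coefficients 𝓕⁻ g(k₁ / 2^s) c(k₂), where c is square summable. Summing over k₁ costs
O(2^{2j}), and the clipped sum over k₂ tends to zero by dominated convergence as β_j → 0
(`eventually_tsum_small_coeff_lineApprox_le`). -/

noncomputable section

/-! ### Parseval frames and the deterministic thresholding bound -/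

section ParsevalFrame

variable {H : Type*} [NormedAddCommGroup H] [InnerProductSpace ℂ H] {I : Type*}

/-- A Parseval frame: the coefficients of every vector have its norm. -/
def IsParsevalFrame (Φ : I → H) : Prop :=
  ∀ x, HasSum (fun i => ‖inner ℂ (Φ i) x‖ ^ 2) (‖x‖ ^ 2)

/-- The analysis operator of a Parseval frame. -/
def IsParsevalFrame.analysis {Φ : I → H} (hΦ : IsParsevalFrame Φ) :
    H →ₗᵢ[ℂ] lp (fun _ : I => ℂ) 2 where
  toFun x := ⟨fun i => inner ℂ (Φ i) x, memℓp_gen (by simpa using (hΦ x).summable)⟩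
  map_add' x y := by ext i; exact inner_add_right _ _ _
  map_smul' c x := by ext i; exact inner_smul_right _ _ _
  norm_map' x := by
    have h1 := lp.norm_rpow_eq_tsum (p := 2) (by norm_num)
      (⟨fun i => inner ℂ (Φ i) x, memℓp_gen (by simpa using (hΦ x).summable)⟩ :
        lp (fun _ : I => ℂ) 2)
    simp only [ENNReal.toReal_ofNat, Real.rpow_ofNat] at h1
    rw [(hΦ x).tsum_eq] at h1
    exact (sq_eq_sq₀ (norm_nonneg _) (norm_nonneg _)).1 h1

theorem IsParsevalFrame.analysis_apply {Φ : I → H} (hΦ : IsParsevalFrame Φ) (x : H) (i : I) :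
    hΦ.analysis x i = inner ℂ (Φ i) x := rfl

variable [CompleteSpace H]

/-- The synthesis operator of a Parseval frame. -/
def IsParsevalFrame.synthesis {Φ : I → H} (hΦ : IsParsevalFrame Φ) :
    lp (fun _ : I => ℂ) 2 →L[ℂ] H :=
  hΦ.analysis.toContinuousLinearMap.adjoint

/-- Analysis is an isometry A, so A*A is the identity; A A* need not be, since the frame may be
redundant. -/
theorem IsParsevalFrame.synthesis_analysis {Φ : I → H} (hΦ : IsParsevalFrame Φ) (x : H) :
    hΦ.synthesis (hΦ.analysis x) = x := by
  refine ext_inner_left ℂ fun y => ?_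
  rw [IsParsevalFrame.synthesis]
  erw [ContinuousLinearMap.adjoint_inner_right]
  exact hΦ.analysis.inner_map_map y x

theorem IsParsevalFrame.norm_synthesis_le {Φ : I → H} (hΦ : IsParsevalFrame Φ)
    (c : lp (fun _ : I => ℂ) 2) : ‖hΦ.synthesis c‖ ≤ ‖c‖ := by
  refine (hΦ.synthesis.le_opNorm c).trans (mul_le_of_le_one_left (norm_nonneg _) ?_)
  rw [IsParsevalFrame.synthesis, LinearIsometryEquiv.norm_map]
  exact hΦ.analysis.norm_toContinuousLinearMap_le

theorem IsParsevalFrame.synthesis_single {Φ : I → H} (hΦ : IsParsevalFrame Φ) [DecidableEq I]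
    (i : I) (c : ℂ) : hΦ.synthesis (lp.single 2 i c) = c • Φ i := by
  refine ext_inner_right ℂ fun y => ?_
  rw [IsParsevalFrame.synthesis]
  erw [ContinuousLinearMap.adjoint_inner_left]
  rw [lp.inner_single_left, inner_smul_left]
  simp [IsParsevalFrame.analysis_apply, mul_comm]

/-- The sequence with all entries outside `T` replaced by zero. -/
def lpRestrict (T : Set I) (c : lp (fun _ : I => ℂ) 2) : lp (fun _ : I => ℂ) 2 :=
  ⟨T.indicator c, by
    have h := lp.memℓp c
    refine memℓp_gen ?_
    refine ((memℓp_gen_iff (by norm_num)).1 h).of_nonneg_of_le (fun i => by positivity) fun i => ?_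
    gcongr
    exact norm_indicator_le_norm_self _ _⟩

open Classical in
theorem lpRestrict_apply (T : Set I) (c : lp (fun _ : I => ℂ) 2) (i : I) :
    lpRestrict T c i = if i ∈ T then c i else 0 :=
  Set.indicator_apply _ _ _

/-- A square summable sequence is the unconditional ℓ² sum of its single entries, and bounded
synthesis carries this convergence to H. -/
theorem IsParsevalFrame.isPartialReconstruction {Φ : I → H} (hΦ : IsParsevalFrame Φ) (T : Set I)
    (z : H) :
    IsPartialReconstruction Φ T z (hΦ.synthesis (lpRestrict T (hΦ.analysis z))) := by
  classical
  have h := (lp.hasSum_single (E := fun _ : I => ℂ) (p := 2) (by norm_num)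
    (lpRestrict T (hΦ.analysis z))).mapL hΦ.synthesis
  unfold IsPartialReconstruction
  have h2 : (fun i : T => inner ℂ (Φ (i : I)) z • Φ (i : I)) =
      (fun i => inner ℂ (Φ i) z • Φ i) ∘ ((↑) : T → I) := rfl
  rw [h2, hasSum_subtype_iff_indicator]
  refine h.congr_fun ?_
  intro i
  rw [hΦ.synthesis_single]
  by_cases hi : i ∈ T <;> simp [lpRestrict, hi, hΦ.analysis_apply]

/-- The energy of `x` that one-step hard thresholding with the coefficients of `f` loses is
controlled by the energy of the small coefficients of an approximation `y` of `f`. -/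
theorem IsParsevalFrame.norm_reconstruction_sub_le {Φ : I → H} (hΦ : IsParsevalFrame Φ)
    {x f y z : H} {β m : ℝ} (hβ : 0 ≤ β) (hm : 0 ≤ m) (hz : ‖z - x‖ ≤ ‖x - f‖)
    (hsum : ∑' i, ENNReal.ofReal (min ‖inner ℂ (Φ i) y‖ β ^ 2) ≤ ENNReal.ofReal (m ^ 2)) :
    ∃ L, IsPartialReconstruction Φ (thresholdSet Φ f β) z L ∧
      ‖L - x‖ ≤ 5 * ‖x - f‖ + 2 * ‖x - y‖ + 2 * m := by
  set T := thresholdSet Φ f β with hT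
  refine ⟨_, hΦ.isPartialReconstruction T z, ?_⟩
  set A := hΦ.analysis with hA
  -- Write x = A*A x and split its coefficients over T and Tᶜ.
  have e1 : hΦ.synthesis (lpRestrict T (A z)) - x =
      hΦ.synthesis (lpRestrict T (A (z - x)) - lpRestrict Tᶜ (A x)) := by
    conv_lhs => rw [← hΦ.synthesis_analysis x]
    rw [← map_sub]
    congr 1
    ext i
    change lpRestrict T (A z) i - A x i = lpRestrict T (A (z - x)) i - lpRestrict Tᶜ (A x) i
    by_cases hi : i ∈ T <;> simp [lpRestrict_apply, hi]
  have n1 : ∀ (S : Set I) c, ‖lpRestrict S c‖ ≤ ‖c‖ := by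
    intro S c
    refine lp.norm_mono (p := 2) (by norm_num) fun i => ?_
    exact norm_indicator_le_norm_self _ _
  have e2 : lpRestrict Tᶜ (A x) = lpRestrict Tᶜ (A (x - f)) + lpRestrict Tᶜ (A f) := by
    ext i
    change lpRestrict Tᶜ (A x) i = lpRestrict Tᶜ (A (x - f)) i + lpRestrict Tᶜ (A f) i
    by_cases hi : i ∈ T <;> simp [lpRestrict_apply, hi]
  -- the coefficients below the threshold
  have hs : Summable fun i => min ‖inner ℂ (Φ i) y‖ β ^ 2 := by
    refine (hΦ y).summable.of_nonneg_of_le (fun i => by positivity) fun i => ?_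
    have : 0 ≤ min ‖inner ℂ (Φ i) y‖ β := le_min (norm_nonneg _) hβ
    gcongr
    exact min_le_left _ _
  have hs' : ∑' i, min ‖inner ℂ (Φ i) y‖ β ^ 2 ≤ m ^ 2 := by
    rw [← ENNReal.ofReal_tsum_of_nonneg (fun i => by positivity) hs] at hsum
    exact (ENNReal.ofReal_le_ofReal_iff (by positivity)).1 hsum
  have e3 : ‖lpRestrict Tᶜ (A f)‖ ^ 2 ≤ 2 * m ^ 2 + 2 * ‖f - y‖ ^ 2 := by
    have h1 := lp.norm_rpow_eq_tsum (p := 2) (by norm_num) (lpRestrict Tᶜ (A f))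
    simp only [ENNReal.toReal_ofNat, Real.rpow_ofNat] at h1
    rw [h1]
    have hs2 := (hs.hasSum.mul_left 2).add ((hΦ (f - y)).mul_left 2)
    have hle : ∀ i, ‖lpRestrict Tᶜ (A f) i‖ ^ 2 ≤
        2 * min ‖inner ℂ (Φ i) y‖ β ^ 2 + 2 * ‖inner ℂ (Φ i) (f - y)‖ ^ 2 := by
      intro i
      by_cases hi : i ∈ T
      · simp only [lpRestrict_apply, Set.mem_compl_iff, hi, not_true_eq_false, if_false, norm_zero]
        rw [zero_pow two_ne_zero]
        positivity
      · have h1 : ‖inner ℂ (Φ i) f‖ < β := by simpa [hT, thresholdSet] using hi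
        have h2 : A f i = inner ℂ (Φ i) f := rfl
        simp only [lpRestrict_apply, Set.mem_compl_iff, hi, not_false_eq_true, if_true, h2,
          inner_sub_right]
        set u := inner ℂ (Φ i) f
        set v := inner ℂ (Φ i) y
        -- If |v| ≤ β this is the triangle inequality; otherwise the minimum is β, which already
        -- exceeds |u| because the index is outside T.
        have h3 : ‖u‖ ≤ min ‖v‖ β + ‖u - v‖ := by
          rcases le_total ‖v‖ β with h | h
          · rw [min_eq_left h]
            linarith [norm_sub_norm_le u v]
          · rw [min_eq_right h]
            linarith [norm_nonneg (u - v)]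
        nlinarith [norm_nonneg u, sq_nonneg (min ‖v‖ β - ‖u - v‖)]
    refine ((hs2.summable.of_nonneg_of_le (fun i => by positivity) hle).tsum_le_tsum hle
      hs2.summable).trans ?_
    rw [hs2.tsum_eq]
    linarith
  have e4 : ‖lpRestrict Tᶜ (A f)‖ ≤ 2 * m + 2 * ‖f - y‖ :=
    abs_le_of_sq_le_sq' (by nlinarith [norm_nonneg (f - y)]) (by positivity) |>.2
  have e5 : ‖f - y‖ ≤ ‖x - f‖ + ‖x - y‖ := by
    rw [norm_sub_rev x f]
    exact norm_sub_le_norm_sub_add_norm_sub f x y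
  rw [e1, e2]
  refine (hΦ.norm_synthesis_le _).trans ((norm_sub_le _ _).trans ?_)
  have n2 := (n1 T (A (z - x))).trans_eq (A.norm_map _)
  have n3 := (norm_add_le _ _).trans (add_le_add ((n1 Tᶜ (A (x - f))).trans_eq (A.norm_map _)) e4)
  -- Four copies of ‖x - f‖ arise: from z - x, from replacing x by f off T, and two from `e5`; the
  -- fifth is slack.
  linarith [norm_nonneg (x - f)]

end ParsevalFrame

/-! ### The Fourier transform on L¹ ∩ L² -/

section FourierL2

variable {V : Type*} [NormedAddCommGroup V] [InnerProductSpace ℝ V] [FiniteDimensional ℝ V]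
  [MeasurableSpace V] [BorelSpace V]

/-- On `L¹ ∩ L²` the `L²` inverse Fourier transform is given by the Fourier integral. -/
theorem coeFn_fourierInv_toLp {G : V → ℂ} (h1 : Integrable G) (h2 : MemLp G 2) :
    (𝓕⁻ (h2.toLp G) : Lp ℂ 2 (volume : Measure V)) =ᵐ[volume] 𝓕⁻ G := by
  have hcont : Continuous (𝓕⁻ G) := by
    have := (Real.Lp.fourierTransformInv (memLp_one_iff_integrable.2 h1 |>.toLp G)).continuous
    rwa [Real.Lp.fourierTransformInv_toLp] at this
  -- Both sides are locally integrable, so it suffices to test against smooth compactly supported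
  -- functions: the L² transform moves onto the test function as a tempered distribution, the
  -- integral by Fubini.
  refine ae_eq_of_integral_contDiff_smul_eq ((Lp.memLp _).locallyIntegrable (by norm_num))
    hcont.locallyIntegrable fun g g_smooth g_cpt => ?_
  have hg₁ : HasCompactSupport (Complex.ofRealCLM ∘ g) := g_cpt.comp_left rfl
  have hg₂ : ContDiff ℝ ∞ (Complex.ofRealCLM ∘ g) := by fun_prop
  set φ := hg₁.toSchwartzMap hg₂ with hφ
  have e1 := congrArg (fun T => T φ) (Lp.fourierInv_toTemperedDistribution_eq (h2.toLp G))
  simp only [TemperedDistribution.fourierInv_apply, Lp.toTemperedDistribution_apply] at e1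
  have e2 : ∫ x, (𝓕⁻ φ) x • (h2.toLp G) x = ∫ x, (𝓕⁻ (φ : V → ℂ)) x * G x := by
    rw [SchwartzMap.fourierInv_coe]
    refine integral_congr_ae ?_
    filter_upwards [h2.coeFn_toLp] with x hx
    rw [hx, smul_eq_mul]
  have e3 : ∫ x, (𝓕⁻ (φ : V → ℂ)) x * G x = ∫ x, φ x * (𝓕⁻ G) x := by
    have := VectorFourier.integral_fourierIntegral_smul_eq_flip (μ := volume) (ν := volume)
      (L := -innerₗ V) (e := Real.fourierChar) Real.continuous_fourierChar
      (by simp only [LinearMap.neg_apply, innerₗ_apply_apply]; fun_prop) φ.integrable h1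
    -- Symmetry of the kernel makes the inverse transform its own transpose.
    have hflip : (-innerₗ V).flip = -innerₗ V := by
      ext x y
      simp [real_inner_comm]
    rw [hflip] at this
    exact this
  refine Eq.trans ?_ (e1.symm.trans (e2.trans (e3.trans ?_)))
  · simp [hφ]
  · rfl

theorem memLp_fourierInv {G : V → ℂ} (h1 : Integrable G) (h2 : MemLp G 2) :
    MemLp (𝓕⁻ G) 2 :=
  (memLp_congr_ae (coeFn_fourierInv_toLp h1 h2)).1 (Lp.memLp _)

theorem toLp_fourierInv {G : V → ℂ} (h1 : Integrable G) (h2 : MemLp G 2) :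
    (memLp_fourierInv h1 h2).toLp (𝓕⁻ G) = 𝓕⁻ (h2.toLp G) := by
  refine Lp.ext ((MemLp.coeFn_toLp _).trans (coeFn_fourierInv_toLp h1 h2).symm)

theorem norm_fourierInv_L2 (f : Lp ℂ 2 (volume : Measure V)) : ‖𝓕⁻ f‖ = ‖f‖ :=
  (Lp.fourierTransformₗᵢ V ℂ).symm.norm_map f

theorem inner_fourierInv_L2 (f g : Lp ℂ 2 (volume : Measure V)) :
    inner ℂ (𝓕⁻ f) (𝓕⁻ g) = inner ℂ f g :=
  (Lp.fourierTransformₗᵢ V ℂ).symm.inner_map_map f g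

theorem inner_toLp_toLp {α : Type*} [MeasurableSpace α] {μ : Measure α} {f g : α → ℂ}
    (hf : MemLp f 2 μ) (hg : MemLp g 2 μ) :
    inner ℂ (hf.toLp f) (hg.toLp g) = ∫ x, (starRingEnd ℂ) (f x) * g x ∂μ := by
  rw [L2.inner_def]
  refine integral_congr_ae ?_
  filter_upwards [hf.coeFn_toLp, hg.coeFn_toLp] with x h1 h2
  rw [h1, h2, RCLike.inner_apply, mul_comm]

theorem ofReal_norm_toLp_sq {α : Type*} [MeasurableSpace α] {μ : Measure α} {f : α → ℂ}
    (hf : MemLp f 2 μ) :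
    ENNReal.ofReal (‖hf.toLp f‖ ^ 2) = ∫⁻ x, ‖f x‖ₑ ^ 2 ∂μ := by
  rw [Lp.norm_toLp, ENNReal.ofReal_pow ENNReal.toReal_nonneg, ENNReal.ofReal_toReal hf.2.ne,
    eLpNorm_eq_lintegral_rpow_enorm_toReal (by norm_num) (by norm_num), ← ENNReal.rpow_natCast,
    ← ENNReal.rpow_mul]
  simp

theorem memLp_two_iff {α : Type*} [MeasurableSpace α] {μ : Measure α} {f : α → ℂ}
    (hf : AEStronglyMeasurable f μ) : MemLp f 2 μ ↔ ∫⁻ x, ‖f x‖ₑ ^ 2 ∂μ < ⊤ := by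
  rw [MemLp, and_iff_right hf, eLpNorm_lt_top_iff_lintegral_rpow_enorm_lt_top (by norm_num)
    (by norm_num)]
  simp

end FourierL2

/-! ### Separable functions on the plane -/

section PlaneCoordinates

/-- The coordinates on the plane. -/
def planeEquiv : Plane ≃ᵐ ℝ × ℝ :=
  (MeasurableEquiv.toLp 2 (Fin 2 → ℝ)).symm.trans MeasurableEquiv.finTwoArrow

theorem measurePreserving_planeEquiv :
    MeasurePreserving planeEquiv (volume : Measure Plane) (volume.prod volume) :=
  (volume_preserving_finTwoArrow ℝ).comp
    (EuclideanSpace.volume_preserving_symm_measurableEquiv_toLp (Fin 2))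

theorem integral_plane {E : Type*} [NormedAddCommGroup E] [NormedSpace ℝ E] (f : ℝ × ℝ → E) :
    ∫ x : Plane, f (x 0, x 1) = ∫ p, f p ∂(volume.prod volume) :=
  measurePreserving_planeEquiv.integral_comp planeEquiv.measurableEmbedding f

theorem lintegral_plane (f : ℝ × ℝ → ℝ≥0∞) :
    ∫⁻ x : Plane, f (x 0, x 1) = ∫⁻ p, f p ∂(volume.prod volume) :=
  measurePreserving_planeEquiv.lintegral_comp_emb planeEquiv.measurableEmbedding f

theorem integral_plane_mul (f g : ℝ → ℂ) :
    ∫ x : Plane, f (x 0) * g (x 1) = (∫ s, f s) * ∫ t, g t := by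
  rw [integral_plane fun p => f p.1 * g p.2, integral_prod_mul]

theorem lintegral_plane_mul {f g : ℝ → ℝ≥0∞} (hf : AEMeasurable f) (hg : AEMeasurable g) :
    ∫⁻ x : Plane, f (x 0) * g (x 1) = (∫⁻ s, f s) * ∫⁻ t, g t := by
  rw [lintegral_plane fun p => f p.1 * g p.2, lintegral_prod_mul hf hg]

theorem integrable_plane_mul {f g : ℝ → ℂ} (hf : Integrable f) (hg : Integrable g) :
    Integrable fun x : Plane => f (x 0) * g (x 1) :=
  (measurePreserving_planeEquiv.integrable_comp_emb planeEquiv.measurableEmbedding).2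
    (hf.mul_prod hg)

theorem aestronglyMeasurable_plane_mul {f g : ℝ → ℂ} (hf : AEStronglyMeasurable f)
    (hg : AEStronglyMeasurable g) :
    AEStronglyMeasurable (fun x : Plane => f (x 0) * g (x 1)) volume :=
  AEStronglyMeasurable.comp_measurePreserving (f := planeEquiv)
    (hf.comp_fst.mul hg.comp_snd) measurePreserving_planeEquiv

theorem lintegral_enorm_plane_mul {f g : ℝ → ℂ} (hf : AEStronglyMeasurable f)
    (hg : AEStronglyMeasurable g) :
    ∫⁻ x : Plane, ‖f (x 0) * g (x 1)‖ₑ ^ 2 = (∫⁻ s, ‖f s‖ₑ ^ 2) * ∫⁻ t, ‖g t‖ₑ ^ 2 := by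
  simp_rw [enorm_mul, mul_pow]
  exact lintegral_plane_mul (hf.enorm.pow_const 2) (hg.enorm.pow_const 2)

theorem memLp_plane_mul {f g : ℝ → ℂ} (hf : MemLp f 2) (hg : MemLp g 2) :
    MemLp (fun x : Plane => f (x 0) * g (x 1)) 2 := by
  rw [memLp_two_iff (aestronglyMeasurable_plane_mul hf.1 hg.1), lintegral_enorm_plane_mul hf.1 hg.1]
  exact ENNReal.mul_lt_top ((memLp_two_iff hf.1).1 hf) ((memLp_two_iff hg.1).1 hg)

theorem norm_toLp_plane_mul {f g : ℝ → ℂ} (hf : MemLp f 2) (hg : MemLp g 2) :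
    ‖(memLp_plane_mul hf hg).toLp _‖ = ‖hf.toLp f‖ * ‖hg.toLp g‖ := by
  have h := ofReal_norm_toLp_sq (memLp_plane_mul hf hg)
  rw [lintegral_enorm_plane_mul hf.1 hg.1, ← ofReal_norm_toLp_sq hf, ← ofReal_norm_toLp_sq hg,
    ← ENNReal.ofReal_mul (by positivity), ENNReal.ofReal_eq_ofReal_iff (by positivity)
    (by positivity), ← mul_pow] at h
  exact (sq_eq_sq₀ (by positivity) (by positivity)).1 h

theorem plane_inner (x y : Plane) : inner ℝ x y = x 0 * y 0 + x 1 * y 1 := by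
  simp [PiLp.inner_apply, Fin.sum_univ_two, mul_comm]

theorem fourierInv_plane_mul (f g : ℝ → ℂ) (x : Plane) :
    𝓕⁻ (fun ξ : Plane => f (ξ 0) * g (ξ 1)) x = 𝓕⁻ f (x 0) * 𝓕⁻ g (x 1) := by
  simp only [Real.fourierInv_eq']
  rw [← integral_plane_mul]
  refine integral_congr_ae (Eventually.of_forall fun ξ => ?_)
  simp only [plane_inner, smul_eq_mul, RCLike.inner_apply, conj_trivial]
  rw [mul_mul_mul_comm, ← Complex.exp_add]
  congr 2
  push_cast
  ring

end PlaneCoordinates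

/-! ### Parseval's identity on cubes -/

section TorusParseval

local instance : MeasureSpace UnitAddCircle := ⟨AddCircle.haarAddCircle⟩

/-- Parseval's identity for square integrable functions supported in the unit cube. -/
theorem tsum_enorm_sq_integral_cube {d : Type*} [Fintype d] {Q : (d → ℝ) → ℂ} (hQ : MemLp Q 2)
    (hs : ∀ x, (¬ ∀ i, x i ∈ Set.Ioc (-(1 / 2) : ℝ) (-(1 / 2) + 1)) → Q x = 0) :
    ∑' k : d → ℤ, ‖∫ x, Complex.exp (2 * Real.pi * Complex.I * ∑ i, ((k i * x i : ℝ) : ℂ)) * Q x‖ₑ ^ 2 =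
      ∫⁻ x, ‖Q x‖ₑ ^ 2 := by
  set a : d → ℝ := fun _ => -(1 / 2) with ha
  set B : Set (d → ℝ) := {x | ∀ i, x i ∈ Set.Ioc (a i) (a i + 1)} with hB
  have hBm : MeasurableSet B := MeasurableSet.univ_pi' fun i => measurableSet_Ioc
  -- The periodization of Q: the half-open unit cube is a fundamental domain for the torus.
  set q : UnitAddTorus d → ℂ := fun t => Q (UnitAddTorus.measurableEquivPiIoc a t).1 with hq
  have hqB : ∀ x ∈ B, q (fun i => x i) = Q x := by
    intro x hx
    have : (fun i => (x i : UnitAddCircle)) = (UnitAddTorus.measurableEquivPiIoc a).symm ⟨x, hx⟩ :=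
      rfl
    simp only [hq]
    rw [this, MeasurableEquiv.apply_symm_apply]
  have hqm : AEStronglyMeasurable q volume := by
    have h1 : MeasurePreserving (fun t => (UnitAddTorus.measurableEquivPiIoc a t).1)
        (volume : Measure (UnitAddTorus d)) (volume.restrict B) :=
      (measurePreserving_subtype_coe hBm).comp (UnitAddTorus.measurePreserving_equivPiIoc a)
    exact hQ.1.restrict.comp_measurePreserving h1
  have hlin : ∫⁻ t, ‖q t‖ₑ ^ 2 = ∫⁻ x, ‖Q x‖ₑ ^ 2 := by
    rw [UnitAddTorus.lintegral_preimage _ a, ← lintegral_indicator hBm]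
    refine lintegral_congr fun x => ?_
    by_cases hx : x ∈ B
    · rw [Set.indicator_of_mem hx, hqB x hx]
    · rw [Set.indicator_of_notMem hx, hs x hx]
      simp
  have hqL : MemLp q 2 := by
    rw [memLp_two_iff hqm, hlin]
    exact (memLp_two_iff hQ.1).1 hQ
  -- Torus coefficients carry the conjugate exponential, hence the sign of k; the final reindexing
  -- by negation absorbs it.
  have hcoef : ∀ k : d → ℤ, UnitAddTorus.mFourierCoeff (hqL.toLp q) (-k) =
      ∫ x, Complex.exp (2 * Real.pi * Complex.I * ∑ i, ((k i * x i : ℝ) : ℂ)) * Q x := by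
    intro k
    have h1 : UnitAddTorus.mFourierCoeff (hqL.toLp q) (-k) = UnitAddTorus.mFourierCoeff q (-k) := by
      refine integral_congr_ae ?_
      filter_upwards [hqL.coeFn_toLp] with t ht
      rw [ht]
    rw [h1, UnitAddTorus.mFourierCoeff_eq_integral _ _ a, ← integral_indicator hBm]
    refine integral_congr_ae (Eventually.of_forall fun x => ?_)
    by_cases hx : x ∈ B
    · simp only [Set.indicator_of_mem hx]
      rw [hqB x hx, smul_eq_mul]
      congr 1
      simp only [UnitAddTorus.mFourier, neg_neg, ContinuousMap.coe_mk, fourier_coe_apply]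
      rw [← Complex.exp_sum, Finset.mul_sum]
      congr 1
      refine Finset.sum_congr rfl fun i _ => ?_
      push_cast
      ring
    · simp only [Set.indicator_of_notMem hx]
      rw [hs x hx, mul_zero]
  have h := UnitAddTorus.hasSum_sq_mFourierCoeff (hqL.toLp q)
  have h2 : ENNReal.ofReal (∫ t, ‖hqL.toLp q t‖ ^ 2) = ∫⁻ t, ‖q t‖ₑ ^ 2 := by
    rw [ofReal_integral_eq_lintegral_ofReal ((Lp.memLp _).integrable_norm_pow two_ne_zero)
      (Eventually.of_forall fun _ => by positivity)]
    refine lintegral_congr_ae ?_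
    filter_upwards [hqL.coeFn_toLp] with t ht
    rw [ht, ENNReal.ofReal_pow (norm_nonneg _), ofReal_norm]
  rw [← hlin, ← h2, ← h.tsum_eq, ENNReal.ofReal_tsum_of_nonneg (fun _ => by positivity) h.summable,
    ← (Equiv.neg (d → ℤ)).tsum_eq]
  refine tsum_congr fun k => ?_
  rw [Equiv.neg_apply, ← hcoef, neg_neg, ENNReal.ofReal_pow (norm_nonneg _), ofReal_norm]


/-- Parseval's identity for square integrable functions on the line supported in an interval of
length one. -/
theorem tsum_enorm_sq_integral_interval {q : ℝ → ℂ} (hq : MemLp q 2)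
    (hs : ∀ u, 1 / 4 < |u| → q u = 0) :
    ∑' k : ℤ, ‖∫ u, Complex.exp (2 * Real.pi * Complex.I * (k * u : ℝ)) * q u‖ₑ ^ 2 =
      ∫⁻ u, ‖q u‖ₑ ^ 2 := by
  have e := volume_preserving_funUnique Unit ℝ
  have em := (MeasurableEquiv.funUnique Unit ℝ).measurableEmbedding
  have h := tsum_enorm_sq_integral_cube (Q := fun v : Unit → ℝ => q (v default))
    (hq.comp_measurePreserving e) (by
      intro v hv
      refine hs _ (not_le.1 fun hc => hv fun i => ?_)
      rw [Unique.eq_default i]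
      obtain ⟨h1, h2⟩ := abs_le.1 hc
      constructor <;> linarith)
  have e2 : ∫⁻ v : Unit → ℝ, ‖q (v default)‖ₑ ^ 2 = ∫⁻ u, ‖q u‖ₑ ^ 2 :=
    e.lintegral_comp_emb em fun u => ‖q u‖ₑ ^ 2
  rw [e2, ← (Equiv.funUnique Unit ℤ).symm.tsum_eq] at h
  rw [← h]
  refine tsum_congr fun k => ?_
  rw [← e.integral_comp em]
  simp

theorem lintegral_comp_smul_plane {M : ℝ} (hM : 0 < M) (f : Plane → ℝ≥0∞) :
    ENNReal.ofReal M ^ 2 * ∫⁻ x, f (M • x) = ∫⁻ x, f x := by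
  have h1 := Measure.map_addHaar_smul (volume : Measure Plane) hM.ne'
  have h2 : ∫⁻ x, f (M • x) = ∫⁻ x, f x ∂(Measure.map (M • ·) (volume : Measure Plane)) :=
    ((Homeomorph.smulOfNeZero M hM.ne').measurableEmbedding.lintegral_map _).symm
  rw [h2, h1, lintegral_smul_measure, finrank_euclideanSpace_fin, smul_eq_mul, ← mul_assoc,
    abs_of_pos (by positivity), ← ENNReal.ofReal_pow hM.le, ← ENNReal.ofReal_mul (by positivity),
    mul_inv_cancel₀ (by positivity), ENNReal.ofReal_one, one_mul]

theorem integral_comp_smul_plane {M : ℝ} (hM : 0 < M) (f : Plane → ℂ) :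
    (M : ℂ) ^ 2 * ∫ x, f (M • x) = ∫ x, f x := by
  rw [Measure.integral_comp_smul, finrank_euclideanSpace_fin, abs_of_pos (by positivity),
    Complex.real_smul]
  push_cast
  rw [← mul_assoc, mul_inv_cancel₀ (by exact_mod_cast (pow_pos hM 2).ne'), one_mul]

theorem MemLp.comp_smul_plane {M : ℝ} (hM : 0 < M) {P : Plane → ℂ} (hP : MemLp P 2) :
    MemLp (fun x => P (M • x)) 2 := by
  have h1 := Measure.map_addHaar_smul (volume : Measure Plane) hM.ne'
  have hq : Measure.QuasiMeasurePreserving (M • · : Plane → Plane) :=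
    ⟨measurable_const_smul M, by
      rw [h1]; exact Measure.smul_absolutelyContinuous⟩
  have hm : AEStronglyMeasurable (fun x => P (M • x)) := hP.1.comp_quasiMeasurePreserving hq
  rw [memLp_two_iff hm]
  have h3 := lintegral_comp_smul_plane hM fun x => ‖P x‖ₑ ^ 2
  have h4 := (memLp_two_iff hP.1).1 hP
  rw [← h3] at h4
  by_contra hc
  rw [not_lt_top_iff.1 hc, ENNReal.mul_top (by simpa using hM)] at h4
  exact lt_irrefl _ h4

/-- Parseval's identity for square integrable functions supported in a square of side `M`. -/
theorem tsum_enorm_sq_integral_square {M : ℝ} (hM : 0 < M) {P : Plane → ℂ} (hP : MemLp P 2)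
    (hs : ∀ ξ, (M / 4 < |ξ 0| ∨ M / 4 < |ξ 1|) → P ξ = 0) :
    ∑' k : Fin 2 → ℤ, ‖(M : ℂ)⁻¹ * ∫ ξ, Complex.exp (2 * Real.pi * Complex.I *
      (M⁻¹ * (k 0 * ξ 0 + k 1 * ξ 1) : ℝ)) * P ξ‖ₑ ^ 2 = ∫⁻ ξ, ‖P ξ‖ₑ ^ 2 := by
  have e := (EuclideanSpace.volume_preserving_symm_measurableEquiv_toLp (Fin 2)).symm
  have em := (MeasurableEquiv.toLp 2 (Fin 2 → ℝ)).measurableEmbedding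
  -- The factor M makes the dilation unitary on the plane and brings the support into the central
  -- square of half-width 1/4.
  have h := tsum_enorm_sq_integral_cube
    (Q := fun v : Fin 2 → ℝ => M * P (M • WithLp.toLp 2 v))
    (((MemLp.comp_smul_plane hM hP).const_mul (M : ℂ)).comp_measurePreserving e) (by
      intro v hv
      rw [hs, mul_zero]
      by_contra hc
      push Not at hc
      simp only [PiLp.smul_apply, smul_eq_mul, abs_mul, abs_of_pos hM] at hc
      refine hv fun i => ?_
      have : |v i| ≤ 1 / 4 := by
        match i with
        | 0 => exact le_of_mul_le_mul_left (by linarith [hc.1]) hM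
        | 1 => exact le_of_mul_le_mul_left (by linarith [hc.2]) hM
      obtain ⟨h1, h2⟩ := abs_le.1 this
      constructor <;> linarith)
  have h5 : ∫⁻ v : Fin 2 → ℝ, ‖(M : ℂ) * P (M • WithLp.toLp 2 v)‖ₑ ^ 2 = ∫⁻ ξ, ‖P ξ‖ₑ ^ 2 := by
    rw [← lintegral_comp_smul_plane hM, ← lintegral_const_mul' _ _ (by finiteness)]
    refine (e.lintegral_comp_emb em fun x : Plane => ‖(M : ℂ) * P (M • x)‖ₑ ^ 2).trans ?_
    refine lintegral_congr fun x => ?_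
    rw [enorm_mul, mul_pow, ← ofReal_norm (M : ℂ), Complex.norm_real, Real.norm_of_nonneg hM.le]
  rw [h5] at h
  rw [← h]
  refine tsum_congr fun k => ?_
  congr 2
  rw [← integral_comp_smul_plane hM, ← mul_assoc, pow_two,
    inv_mul_cancel_left₀ (by exact_mod_cast hM.ne'), ← integral_const_mul]
  refine (e.integral_comp em (fun x : Plane => (M : ℂ) * (Complex.exp (2 * Real.pi * Complex.I *
      (M⁻¹ * (k 0 * (M • x) 0 + k 1 * (M • x) 1) : ℝ)) * P (M • x)))).symm.trans ?_
  refine integral_congr_ae (Eventually.of_forall fun v => ?_)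
  simp only [Fin.sum_univ_two, PiLp.smul_apply, smul_eq_mul]
  rw [mul_left_comm]
  congr 2
  push_cast
  have : (M : ℂ) ≠ 0 := by exact_mod_cast hM.ne'
  field_simp
  rfl

end TorusParseval

/-! ### The Meyer system is a Parseval frame -/

section MeyerParseval

variable (ν : MeyerTransition) (a b : ℝ)

theorem meyerPhiHat_eq_cos (t : ℝ) :
    meyerPhiHat ν t = (Real.cos (Real.pi / 2 * ν.toFun (16 * |t| - 1)) : ℂ) := by
  unfold meyerPhiHat
  split_ifs with h1 h2
  · rw [ν.eq_zero _ (by linarith)]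
    simp
  · rfl
  · have : 1 / 8 < |t| := by
      by_contra hc
      exact h2 ⟨(not_le.1 h1).le, not_lt.1 hc⟩
    rw [ν.eq_one _ (by linarith)]
    simp

/-- On the inner band sin² = 1 - cos² with φ̂(t/2) = 1; on the outer band φ̂(t) = 0. This turns sums
over scales into telescoping sums. -/
theorem norm_meyerW_sq (t : ℝ) :
    ‖meyerW ν a b t‖ ^ 2 = ‖meyerPhiHat ν (2⁻¹ * t)‖ ^ 2 - ‖meyerPhiHat ν t‖ ^ 2 := by
  have e : 16 * |2⁻¹ * t| - 1 = 8 * |t| - 1 := by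
    rw [abs_mul, abs_of_pos (by norm_num : (0 : ℝ) < 2⁻¹)]
    ring
  simp only [meyerPhiHat_eq_cos, e, Complex.norm_real, Real.norm_eq_abs, sq_abs]
  unfold meyerW
  split_ifs with h1 h2
  · rw [norm_mul, ← Complex.ofReal_neg, Complex.norm_exp_ofReal_mul_I, one_mul, Complex.norm_real,
      Real.norm_eq_abs, sq_abs, ν.eq_zero (8 * |t| - 1) (by linarith [h1.2]), Real.sin_sq]
    simp
  · have h3 : 1 / 8 < |t| := lt_of_not_ge fun hc => h1 ⟨by linarith [h2.1], hc⟩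
    rw [norm_mul, ← Complex.ofReal_neg, Complex.norm_exp_ofReal_mul_I, one_mul, Complex.norm_real,
      Real.norm_eq_abs, sq_abs, ν.eq_one (16 * |t| - 1) (by linarith)]
    simp
  · rcases lt_or_ge |t| (1 / 16) with h | h
    · rw [ν.eq_zero (8 * |t| - 1) (by linarith), ν.eq_zero (16 * |t| - 1) (by linarith)]
      simp
    · have h3 : 1 / 8 < |t| := lt_of_not_ge fun hc => h1 ⟨h, hc⟩
      have h4 : 1 / 4 < |t| := lt_of_not_ge fun hc => h2 ⟨h3.le, hc⟩
      rw [ν.eq_one (8 * |t| - 1) (by linarith), ν.eq_one (16 * |t| - 1) (by linarith)]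
      simp

/-- The energy of the two-dimensional scaling function. -/
def meyerEnergy (ξ : Plane) : ℝ := ‖meyerPhiHat ν (ξ 0)‖ ^ 2 * ‖meyerPhiHat ν (ξ 1)‖ ^ 2

/-- With P, Q the squared moduli of φ̂ in the two coordinates and P', Q' their dilates, this is (P'
- P)Q + P(Q' - Q) + (P' - P)(Q' - Q) = P'Q' - PQ. -/
theorem sum_norm_meyerW2_sq (ξ : Plane) :
    ‖meyerW2 ν a b .h ξ‖ ^ 2 + ‖meyerW2 ν a b .v ξ‖ ^ 2 + ‖meyerW2 ν a b .d ξ‖ ^ 2 =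
      meyerEnergy ν ((2 : ℝ)⁻¹ • ξ) - meyerEnergy ν ξ := by
  simp only [meyerW2, norm_mul, mul_pow, norm_meyerW_sq, meyerEnergy, PiLp.smul_apply, smul_eq_mul]
  ring

theorem meyerPhiHat_eq_one {t : ℝ} (h : |t| ≤ 1 / 16) : meyerPhiHat ν t = 1 := if_pos h

theorem meyerW_eq_zero_of_abs_le {t : ℝ} (h : |t| ≤ 1 / 16) : meyerW ν a b t = 0 := by
  have h1 := norm_meyerW_sq ν a b t
  rw [meyerPhiHat_eq_one ν h, meyerPhiHat_eq_one ν (by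
    rw [abs_mul, abs_of_pos (by norm_num : (0 : ℝ) < 2⁻¹)]
    linarith [abs_nonneg t])] at h1
  simpa using h1

theorem sum_Ico_sub_int (A : ℤ → ℝ) {m n : ℤ} (h : m ≤ n) :
    ∑ s ∈ Finset.Ico m n, (A (s + 1) - A s) = A n - A m := by
  induction n, h using Int.leInduction with
  | base => simp
  | succ n h ih =>
    have : Finset.Ico m (n + 1) = insert n (Finset.Ico m n) := by
      ext
      simp only [Finset.mem_Ico, Finset.mem_insert]
      omega
    rw [this, Finset.sum_insert (by simp), ih]
    ring

theorem hasSum_int_telescope {A : ℤ → ℝ} {n : ℕ} (h0 : ∀ s ≤ -(n : ℤ), A s = 0)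
    (h1 : ∀ s ≥ (n : ℤ), A s = 1) : HasSum (fun s => A (s + 1) - A s) 1 := by
  have h := hasSum_sum_of_ne_finset_zero (f := fun s => A (s + 1) - A s)
    (s := Finset.Ico (-(n : ℤ)) n) (L := SummationFilter.unconditional ℤ) (fun s hs => by
      rw [Finset.mem_Ico, not_and_or, not_le, not_lt] at hs
      rcases hs with hs | hs
      · rw [h0 s hs.le, h0 (s + 1) (by omega), sub_zero]
      · rw [h1 s hs, h1 (s + 1) (by omega), sub_self])
  rwa [sum_Ico_sub_int A (by omega), h0 _ le_rfl, h1 _ le_rfl, sub_zero] at h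

theorem meyerEnergy_eq_one {ξ : Plane} (h : ‖ξ‖ ≤ 1 / 16) : meyerEnergy ν ξ = 1 := by
  have h0 := (PiLp.norm_apply_le ξ 0).trans h
  have h1 := (PiLp.norm_apply_le ξ 1).trans h
  rw [Real.norm_eq_abs] at h0 h1
  simp [meyerEnergy, meyerPhiHat_eq_one ν h0, meyerPhiHat_eq_one ν h1]

theorem meyerEnergy_eq_zero {ξ : Plane} (h : 1 < ‖ξ‖) : meyerEnergy ν ξ = 0 := by
  have key : 1 / 4 < |ξ 0| ∨ 1 / 4 < |ξ 1| := by
    by_contra hc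
    push Not at hc
    have hn : ‖ξ‖ ^ 2 = |ξ 0| ^ 2 + |ξ 1| ^ 2 := by
      rw [EuclideanSpace.norm_sq_eq]; simp [Fin.sum_univ_two]
    nlinarith [abs_nonneg (ξ 0), abs_nonneg (ξ 1), hc.1, hc.2]
  rcases key with k | k <;>
    simp [meyerEnergy, meyerPhiHat_eq_zero ν _ k]

/-- The squared moduli of the Meyer windows form a partition of unity away from the origin. -/
theorem hasSum_norm_meyerW2_sq {ξ : Plane} (hξ : ξ ≠ 0) :
    HasSum (fun s : ℤ => ‖meyerW2 ν a b .h ((2 : ℝ) ^ (-s) • ξ)‖ ^ 2 +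
      ‖meyerW2 ν a b .v ((2 : ℝ) ^ (-s) • ξ)‖ ^ 2 +
      ‖meyerW2 ν a b .d ((2 : ℝ) ^ (-s) • ξ)‖ ^ 2) 1 := by
  have hpos : 0 < ‖ξ‖ := norm_pos_iff.2 hξ
  -- For s ≥ n the bound 16‖ξ‖ puts the dilate in the ball of radius 1/16, where the energy is 1;
  -- for s ≤ -n the bound ‖ξ‖⁻¹ puts it outside the unit ball, where the energy is 0.
  obtain ⟨n, hn⟩ := pow_unbounded_of_one_lt (max (16 * ‖ξ‖) ‖ξ‖⁻¹) (one_lt_two (α := ℝ))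
  obtain ⟨hn1, hn2⟩ := max_lt_iff.1 hn
  have hnorm : ∀ s : ℤ, ‖(2 : ℝ) ^ (-s) • ξ‖ = (2 : ℝ) ^ (-s) * ‖ξ‖ := fun s => by
    rw [norm_smul, Real.norm_of_nonneg (by positivity)]
  refine (hasSum_int_telescope (A := fun s => meyerEnergy ν ((2 : ℝ) ^ (-s) • ξ)) (n := n)
    (fun s hs => meyerEnergy_eq_zero ν ?_) (fun s hs => meyerEnergy_eq_one ν ?_)).congr_fun ?_
  · rw [hnorm]
    have : (2 : ℝ) ^ n ≤ (2 : ℝ) ^ (-s) := by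
      rw [← zpow_natCast]
      exact zpow_le_zpow_right₀ one_le_two (by omega)
    calc (1 : ℝ) = ‖ξ‖⁻¹ * ‖ξ‖ := (inv_mul_cancel₀ hpos.ne').symm
      _ < (2 : ℝ) ^ (-s) * ‖ξ‖ := by gcongr; exact hn2.trans_le this
  · rw [hnorm, zpow_neg, inv_mul_le_iff₀ (by positivity)]
    have : (2 : ℝ) ^ n ≤ (2 : ℝ) ^ s := by
      rw [← zpow_natCast]
      exact zpow_le_zpow_right₀ one_le_two (by omega)
    linarith
  · intro s
    rw [sum_norm_meyerW2_sq, smul_smul, neg_add, zpow_add₀ two_ne_zero, zpow_neg_one, mul_comm]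

/-- Meyer indices are triples. -/
def meyerIndexEquiv : WaveletType × ℤ × (Fin 2 → ℤ) ≃ MeyerIndex where
  toFun p := ⟨p.1, p.2.1, p.2.2⟩
  invFun l := (l.type, l.scale, l.pos)
  left_inv _ := rfl
  right_inv _ := rfl

/-- The three wavelet types, enumerated. -/
def waveletTypeEquiv : Fin 3 ≃ WaveletType where
  toFun := ![.h, .v, .d]
  invFun
    | .h => 0
    | .v => 1
    | .d => 2
  left_inv i := by fin_cases i <;> rfl
  right_inv t := by cases t <;> rfl

theorem tsum_meyerIndex (f : MeyerIndex → ℝ≥0∞) :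
    ∑' l, f l = ∑' s, (∑' k, f ⟨.h, s, k⟩ + ∑' k, f ⟨.v, s, k⟩ + ∑' k, f ⟨.d, s, k⟩) := by
  rw [← meyerIndexEquiv.tsum_eq, ENNReal.tsum_prod', ← waveletTypeEquiv.tsum_eq, tsum_fintype,
    Fin.sum_univ_three, ENNReal.tsum_add, ENNReal.tsum_add, ENNReal.tsum_prod', ENNReal.tsum_prod',
    ENNReal.tsum_prod']
  rfl

theorem conj_meyerHat (l : MeyerIndex) (ξ : Plane) :
    (starRingEnd ℂ) (meyerHat ν a b l ξ) = (((2 : ℝ) ^ l.scale : ℝ) : ℂ)⁻¹ *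
      (Complex.exp (2 * Real.pi * Complex.I *
        (((2 : ℝ) ^ l.scale)⁻¹ * (l.pos 0 * ξ 0 + l.pos 1 * ξ 1) : ℝ)) *
      (starRingEnd ℂ) (meyerW2 ν a b l.type ((2 : ℝ) ^ (-l.scale) • ξ))) := by
  unfold meyerHat
  rw [map_mul, map_mul, ← Complex.exp_conj, map_zpow₀, mul_assoc, mul_comm (Complex.exp _)]
  congr 1
  · rw [zpow_neg, Complex.conj_ofNat]
    push_cast
    rfl
  · congr 2
    rw [map_mul, Complex.conj_I, map_neg, Complex.conj_ofReal, zpow_neg]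
    push_cast
    ring

theorem inner_meyerWavelet_fourierInv (l : MeyerIndex) {X : Plane → ℂ} (hX : MemLp X 2) :
    inner ℂ (meyerWavelet ν a b l) (𝓕⁻ (hX.toLp X) : L2Plane) =
      ((((2 : ℝ) ^ l.scale : ℝ) : ℂ))⁻¹ * ∫ ξ, Complex.exp (2 * Real.pi * Complex.I *
        (((2 : ℝ) ^ l.scale)⁻¹ * (l.pos 0 * ξ 0 + l.pos 1 * ξ 1) : ℝ)) *
      ((starRingEnd ℂ) (meyerW2 ν a b l.type ((2 : ℝ) ^ (-l.scale) • ξ)) * X ξ) := by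
  rw [meyerWavelet, inner_fourierInv_L2, inner_toLp_toLp, ← integral_const_mul]
  refine integral_congr_ae (Eventually.of_forall fun ξ => ?_)
  simp only [conj_meyerHat]
  ring

theorem meyerW2_eq_zero_of_coord (t : WaveletType) {ξ : Plane}
    (h : 1 / 4 < |ξ 0| ∨ 1 / 4 < |ξ 1|) : meyerW2 ν a b t ξ = 0 := by
  cases t <;> simp only [meyerW2] <;> rcases h with k | k <;>
    simp [meyerW_eq_zero ν a b _ k, meyerPhiHat_eq_zero ν _ k]

/-- At a fixed type and scale, the coefficients over k are the Fourier coefficients of conj(W^ι) X̂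
on a square of side 2^s. The window is supported where both coordinates are at most 2^s/4 in
modulus, so periodization causes no overlap. -/
theorem tsum_enorm_inner_meyerWavelet (t : WaveletType) (s : ℤ) {X : Plane → ℂ}
    (hX : MemLp X 2) :
    ∑' k, ‖inner ℂ (meyerWavelet ν a b ⟨t, s, k⟩) (𝓕⁻ (hX.toLp X) : L2Plane)‖ₑ ^ 2 =
      ∫⁻ ξ, ENNReal.ofReal (‖meyerW2 ν a b t ((2 : ℝ) ^ (-s) • ξ)‖ ^ 2) * ‖X ξ‖ₑ ^ 2 := by
  simp_rw [inner_meyerWavelet_fourierInv]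
  have hm : Measurable fun ξ : Plane => (starRingEnd ℂ) (meyerW2 ν a b t ((2 : ℝ) ^ (-s) • ξ)) :=
    Complex.continuous_conj.measurable.comp
      ((measurable_meyerW2 ν a b t).comp (measurable_const_smul _))
  have hp : (0 : ℝ) < 2 ^ s := by positivity
  rw [tsum_enorm_sq_integral_square hp]
  · refine lintegral_congr fun ξ => ?_
    rw [enorm_mul, mul_pow, ENNReal.ofReal_pow (norm_nonneg _), ofReal_norm, RCLike.enorm_conj]
  · refine hX.of_le (hm.aestronglyMeasurable.mul hX.1) (Eventually.of_forall fun ξ => ?_)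
    rw [norm_mul, RCLike.norm_conj]
    exact mul_le_of_le_one_left (norm_nonneg _) (norm_meyerW2_le ν a b _ _)
  · intro ξ hξ
    have key : 1 / 4 < |((2 : ℝ) ^ (-s) • ξ) 0| ∨ 1 / 4 < |((2 : ℝ) ^ (-s) • ξ) 1| := by
      simp only [PiLp.smul_apply, smul_eq_mul, abs_mul, zpow_neg, abs_of_pos (inv_pos.2 hp), lt_inv_mul_iff₀ hp]
      refine hξ.imp (fun h => ?_) (fun h => ?_) <;> linarith
    rw [meyerW2_eq_zero_of_coord ν a b t key, map_zero, zero_mul]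

/-- Parseval over k at each scale, then Tonelli over types and scales, reduces the claim to the
dyadic partition of unity by the squared windows. -/
theorem isParsevalFrame_meyerWavelet : IsParsevalFrame (meyerWavelet ν a b) := by
  intro x
  obtain ⟨X, hX, rfl⟩ : ∃ (X : Plane → ℂ) (hX : MemLp X 2 volume), 𝓕⁻ (hX.toLp X) = x :=
    ⟨(𝓕 x : L2Plane), Lp.memLp _, by rw [Lp.toLp_coeFn, FourierTransform.fourierInv_fourier_eq]⟩
  have hm : ∀ t (s : ℤ), AEMeasurable fun ξ : Plane =>
      ENNReal.ofReal (‖meyerW2 ν a b t ((2 : ℝ) ^ (-s) • ξ)‖ ^ 2) * ‖X ξ‖ₑ ^ 2 := fun t s =>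
    ((((measurable_meyerW2 ν a b t).comp (measurable_const_smul _)).norm.pow_const
      2).ennreal_ofReal.aemeasurable).mul (hX.1.enorm.pow_const 2)
  have key : ∑' l, ‖inner ℂ (meyerWavelet ν a b l) (𝓕⁻ (hX.toLp X) : L2Plane)‖ₑ ^ 2 =
      ENNReal.ofReal (‖(𝓕⁻ (hX.toLp X) : L2Plane)‖ ^ 2) := by
    rw [tsum_meyerIndex, norm_fourierInv_L2, ofReal_norm_toLp_sq]
    simp_rw [tsum_enorm_inner_meyerWavelet]
    have e (s : ℤ) := (lintegral_add_left' ((hm .h s).add (hm .v s)) fun ξ =>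
      ENNReal.ofReal (‖meyerW2 ν a b .d ((2 : ℝ) ^ (-s) • ξ)‖ ^ 2) * ‖X ξ‖ₑ ^ 2).symm
    simp only [Pi.add_apply, lintegral_add_left' (hm .h _)] at e
    simp_rw [e]
    refine (lintegral_tsum fun s => ((hm .h s).add (hm .v s)).add (hm .d s)).symm.trans ?_
    refine lintegral_congr_ae ?_
    -- The partition of unity fails only at the origin, a null set.
    filter_upwards [compl_mem_ae_iff.2 (measure_singleton (0 : Plane))] with ξ hξ
    simp only [Pi.add_apply]
    simp_rw [← add_mul]
    rw [ENNReal.tsum_mul_right]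
    have h1 := hasSum_norm_meyerW2_sq ν a b hξ
    simp_rw [← ENNReal.ofReal_add (sq_nonneg _) (sq_nonneg _)]
    simp_rw [← ENNReal.ofReal_add (add_nonneg (sq_nonneg _) (sq_nonneg _)) (sq_nonneg _)]
    rw [← ENNReal.ofReal_tsum_of_nonneg (fun _ => by positivity) h1.summable, h1.tsum_eq]
    simp
  have h2 := ENNReal.hasSum_toReal (key.trans_ne ENNReal.ofReal_ne_top)
  rw [← ENNReal.tsum_toReal_eq fun l => by finiteness, key,
    ENNReal.toReal_ofReal (by positivity)] at h2
  simpa using h2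

end MeyerParseval

/-! ### The vertical frequency profile and its Fourier coefficients -/

section LineProfile

variable (ν : MeyerTransition) (a b : ℝ)

/-- The vertical frequency profile `W(u) + W(u / 2)` of the filters at zero horizontal frequency. -/
def lineProfile (u : ℝ) : ℂ := meyerW ν a b u + meyerW ν a b (2⁻¹ * u)

theorem measurable_lineProfile : Measurable (lineProfile ν a b) :=
  (measurable_meyerW ν a b).add ((measurable_meyerW ν a b).comp (measurable_const_mul _))

theorem norm_lineProfile_le (u : ℝ) : ‖lineProfile ν a b u‖ ≤ 2 := by
  refine (norm_add_le _ _).trans ?_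
  linarith [norm_meyerW_le ν a b u, norm_meyerW_le ν a b (2⁻¹ * u)]

theorem abs_inv_two_mul (u : ℝ) : |2⁻¹ * u| = |u| / 2 := by
  rw [abs_mul, abs_of_pos (by norm_num : (0 : ℝ) < 2⁻¹)]
  ring

theorem lineProfile_eq_zero_of_abs_le {u : ℝ} (h : |u| ≤ 1 / 16) : lineProfile ν a b u = 0 := by
  rw [lineProfile, meyerW_eq_zero_of_abs_le ν a b h, meyerW_eq_zero_of_abs_le ν a b
    (by rw [abs_inv_two_mul]; linarith [abs_nonneg u]), add_zero]

theorem lineProfile_eq_zero_of_lt_abs {u : ℝ} (h : 1 / 2 < |u|) : lineProfile ν a b u = 0 := by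
  rw [lineProfile, meyerW_eq_zero ν a b u (by linarith), meyerW_eq_zero ν a b _
    (by rw [abs_inv_two_mul]; linarith), add_zero]

/-- A bounded measurable function vanishing outside a bounded interval is in every `Lᵖ`. -/
theorem memLp_of_bounded_of_support {f : ℝ → ℂ} (hf : Measurable f) {C R : ℝ}
    (hC : ∀ u, ‖f u‖ ≤ C) (hR : ∀ u, R < |u| → f u = 0) (p : ℝ≥0∞) : MemLp f p := by
  refine (memLp_top_of_bound hf.aestronglyMeasurable C
    (Eventually.of_forall hC)).mono_exponent_of_measure_support_ne_top
      (s := Metric.closedBall (0 : ℝ) R) (fun u hu => hR u ?_)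
      measure_closedBall_lt_top.ne le_top
  simpa using hu

theorem memLp_lineProfile_mul {M : ℝ} (hM : 0 < M) (p : ℝ≥0∞) :
    MemLp (fun u => lineProfile ν a b (M * u)) p := by
  refine memLp_of_bounded_of_support ((measurable_lineProfile ν a b).comp (measurable_const_mul _))
    (fun u => norm_lineProfile_le ν a b _) (R := M⁻¹ * (1 / 2)) (fun u hu => ?_) p
  refine lineProfile_eq_zero_of_lt_abs ν a b ?_
  rwa [abs_mul, abs_of_pos hM, ← inv_mul_lt_iff₀ hM]

/-- The product of the conjugated Meyer window with a dilated line profile. -/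
def profileProduct (i : ℤ) (u : ℝ) : ℂ :=
  (starRingEnd ℂ) (meyerW ν a b u) * lineProfile ν a b ((2 : ℝ) ^ i * u)

theorem memLp_profileProduct (i : ℤ) : MemLp (profileProduct ν a b i) 2 := by
  have hm : Measurable (profileProduct ν a b i) :=
    (Complex.continuous_conj.measurable.comp (measurable_meyerW ν a b)).mul
      ((measurable_lineProfile ν a b).comp (measurable_const_mul _))
  refine memLp_of_bounded_of_support (C := 2) (R := 1 / 4) hm (fun u => ?_) (fun u hu => ?_) 2
  · rw [profileProduct, norm_mul, RCLike.norm_conj]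
    nlinarith [norm_meyerW_le ν a b u, norm_lineProfile_le ν a b (2 ^ i * u),
      norm_nonneg (meyerW ν a b u), norm_nonneg (lineProfile ν a b (2 ^ i * u))]
  · rw [profileProduct, meyerW_eq_zero ν a b u hu, map_zero, zero_mul]

/-- The Fourier coefficients of `profileProduct`. -/
def profileCoeff (i k : ℤ) : ℂ :=
  ∫ u, Complex.exp (2 * Real.pi * Complex.I * (k * u : ℝ)) * profileProduct ν a b i u

/-- Parseval for a bounded function supported in [-1/4, 1/4]. The squares dominate the clipped sums
over the vertical translations. -/
theorem summable_profileCoeff_sq (i : ℤ) : Summable fun k => ‖profileCoeff ν a b i k‖ ^ 2 := by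
  have h := tsum_enorm_sq_integral_interval (memLp_profileProduct ν a b i) (fun u hu => by
    rw [profileProduct, meyerW_eq_zero ν a b u hu, map_zero, zero_mul])
  have h2 := (memLp_two_iff (memLp_profileProduct ν a b i).1).1 (memLp_profileProduct ν a b i)
  rw [← h] at h2
  have := ENNReal.summable_toReal h2.ne
  simpa [profileCoeff] using this

end LineProfile

/-! ### Sums of clipped coefficients -/

section SmallCoefficients

theorem summable_one_div_one_add_sq_int : Summable fun q : ℤ => 1 / (1 + (q : ℝ) ^ 2) := by
  have h : Summable fun q : ℤ => 1 / (q : ℝ) ^ 2 := Real.summable_one_div_int_pow.2 one_lt_two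
  refine Summable.of_norm_bounded_eventually (g := fun q : ℤ => 1 / (q : ℝ) ^ 2) h ?_
  filter_upwards [(Set.finite_singleton (0 : ℤ)).compl_mem_cofinite] with q hq
  have hq' : (q : ℝ) ≠ 0 := by exact_mod_cast hq
  rw [Real.norm_of_nonneg (by positivity)]
  gcongr
  linarith

/-- A bound on Riemann sums of `1 / (1 + t²)`. -/
theorem exists_tsum_riemann_le : ∃ C : ℝ≥0∞, C ≠ ⊤ ∧ ∀ n : ℕ, n ≠ 0 →
    ∑' k : ℤ, ENNReal.ofReal (1 / (1 + (k / n : ℝ) ^ 2)) ≤ C * n := by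
  refine ⟨∑' q : ℤ, ENNReal.ofReal (3 * (1 / (1 + (q : ℝ) ^ 2))),
    (summable_one_div_one_add_sq_int.mul_left 3).tsum_ofReal_ne_top, fun n hn => ?_⟩
  have : NeZero n := ⟨hn⟩
  have hn0 : (0 : ℝ) < n := by positivity
  -- Group k = nq + r with 0 ≤ r < n: each of the n residues contributes at most 3/(1 + q²), because
  -- 1 + q² ≤ 3(1 + (q + θ)²) for 0 ≤ θ ≤ 1.
  rw [← (Int.divModEquiv n).symm.tsum_eq, ENNReal.tsum_prod', ← ENNReal.tsum_mul_right]
  refine ENNReal.tsum_le_tsum fun q => ?_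
  rw [tsum_fintype]
  refine (Finset.sum_le_card_nsmul _ _ (ENNReal.ofReal (3 * (1 / (1 + (q : ℝ) ^ 2))))
    fun r _ => ?_).trans_eq ?_
  · refine ENNReal.ofReal_le_ofReal ?_
    have e : (((Int.divModEquiv n).symm (q, r) : ℤ) / n : ℝ) = q + (r : ℕ) / n := by
      rw [Int.divModEquiv_symm_apply]
      push_cast
      field_simp
    rw [e, mul_one_div, div_le_div_iff₀ (by positivity) (by positivity)]
    have h0 : (0 : ℝ) ≤ (r : ℕ) / n := by positivity
    have h1 : ((r : ℕ) : ℝ) / n ≤ 1 := by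
      rw [div_le_one hn0]
      exact_mod_cast r.2.le
    set θ : ℝ := (r : ℕ) / n
    nlinarith [sq_nonneg ((q : ℝ) + 2 * θ), sq_nonneg ((q : ℝ) + θ)]
  · simp [mul_comm]

/-- One factor of the square keeps the decay h, the other keeps the clipping at β. A double sum over
the two translation directions thereby factors. -/
theorem sq_min_mul_le {x h B β : ℝ} (hx : 0 ≤ x) (hh : 0 ≤ h) (h1 : h ≤ 1) (hB : 0 ≤ B)
    (hβ : 0 ≤ β) (hxB : x ≤ h * B) : min x β ^ 2 ≤ h * (B * min B β) := by
  have e1 : min x β ≤ h * B := (min_le_left _ _).trans hxB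
  have e2 : min x β ≤ min B β := min_le_min_right _ (hxB.trans (mul_le_of_le_one_left hB h1))
  have e3 : 0 ≤ min x β := le_min hx hβ
  calc min x β ^ 2 = min x β * min x β := sq _
    _ ≤ (h * B) * min B β := mul_le_mul e1 e2 e3 (by positivity)
    _ = _ := mul_assoc _ _ _

/-- Dominated convergence with majorant B²: each term vanishes in the limit since min(B, β_j) does.
-/
theorem tendsto_tsum_mul_min {ι : Type*} {B : ι → ℝ} (hB : ∀ k, 0 ≤ B k)
    (hs : Summable fun k => B k ^ 2) {β : ℕ → ℝ} (hβ : ∀ j, 0 < β j)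
    (hlim : Tendsto β atTop (𝓝 0)) :
    Tendsto (fun j => ∑' k, ENNReal.ofReal (B k * min (B k) (β j))) atTop (𝓝 0) := by
  have hle : ∀ j k, B k * min (B k) (β j) ≤ B k ^ 2 := fun j k => by
    rw [sq]
    exact mul_le_mul_of_nonneg_left (min_le_left _ _) (hB k)
  have hnn : ∀ j k, 0 ≤ B k * min (B k) (β j) := fun j k =>
    mul_nonneg (hB k) (le_min (hB k) (hβ j).le)
  have h := tendsto_tsum_of_dominated_convergence 
    (f := fun j k => B k * min (B k) (β j)) (g := fun _ => 0) hs (fun k => by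
      have h1 : Tendsto (fun j => min (B k) (β j)) atTop (𝓝 (min (B k) 0)) :=
        tendsto_const_nhds.min hlim
      rw [min_eq_right (hB k)] at h1
      simpa using h1.const_mul (B k)) (Eventually.of_forall fun j k => by
      rw [Real.norm_of_nonneg (hnn j k)]
      exact hle j k)
  rw [tsum_zero] at h
  have h2 := ENNReal.tendsto_ofReal h
  rw [ENNReal.ofReal_zero] at h2
  refine h2.congr fun j => ?_
  exact ENNReal.ofReal_tsum_of_nonneg (hnn j) (hs.of_nonneg_of_le (hnn j) (hle j))

end SmallCoefficients

/-! ### Frame coefficients of the separable approximation -/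

section LineApprox

variable (ν : MeyerTransition) (a b : ℝ)

/-- The frequency side of the separable approximation of the filtered line singularity. -/
def lineApprox (f : ℝ → ℂ) (j : ℕ) (ξ : Plane) : ℂ :=
  f (ξ 0) * lineProfile ν a b ((2 : ℝ) ^ (-(2 * (j : ℤ))) * ξ 1)

theorem memLp_lineApprox {f : ℝ → ℂ} (hf : MemLp f 2) (j : ℕ) :
    MemLp (lineApprox ν a b f j) 2 :=
  memLp_plane_mul hf (memLp_lineProfile_mul ν a b (by positivity) 2)

theorem abs_zpow_neg_mul (s : ℤ) (x : ℝ) : |(2 : ℝ) ^ (-s) * x| = |x| / 2 ^ s := by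
  rw [abs_mul, abs_of_pos (by positivity), zpow_neg]
  field_simp

theorem mem_support_meyerW {u : ℝ} (h : meyerW ν a b u ≠ 0) : 1 / 16 < |u| ∧ |u| ≤ 1 / 4 :=
  ⟨lt_of_not_ge fun hc => h (meyerW_eq_zero_of_abs_le ν a b hc),
    le_of_not_gt fun hc => h (meyerW_eq_zero ν a b u hc)⟩

theorem mem_support_lineProfile {u : ℝ} (h : lineProfile ν a b u ≠ 0) :
    1 / 16 < |u| ∧ |u| ≤ 1 / 2 :=
  ⟨lt_of_not_ge fun hc => h (lineProfile_eq_zero_of_abs_le ν a b hc),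
    le_of_not_gt fun hc => h (lineProfile_eq_zero_of_lt_abs ν a b hc)⟩

variable {f : ℝ → ℂ} {R : ℝ} (hR : ∀ t, R < |t| → f t = 0)
include hR

/-- On a common support the profile gives |ξ₂| > 2^{2j}/16 and the window gives |ξ₂| ≤ 2^s/4, so 2^s
> 2^{2j}/4. A factor W in ξ₁ then forces |ξ₁| > 2^s/16 > 2^{2j}/64 ≥ R, outside the support of f. -/
theorem conj_meyerW2_mul_lineApprox_eq_zero {t : WaveletType} (ht : t ≠ .v) {j : ℕ}
    (hj : 64 * R ≤ 2 ^ (2 * (j : ℤ))) (s : ℤ) (ξ : Plane) :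
    (starRingEnd ℂ) (meyerW2 ν a b t ((2 : ℝ) ^ (-s) • ξ)) * lineApprox ν a b f j ξ = 0 := by
  by_contra hc
  obtain ⟨h1, h2⟩ := mul_ne_zero_iff.1 hc
  rw [lineApprox] at h2
  obtain ⟨h3, h4⟩ := mul_ne_zero_iff.1 h2
  have h5 := mem_support_lineProfile ν a b h4
  have h6 : |ξ 0| ≤ R := le_of_not_gt fun h => h3 (hR _ h)
  have h7 : meyerW2 ν a b t ((2 : ℝ) ^ (-s) • ξ) ≠ 0 := fun h => h1 (by rw [h, map_zero])
  have h8 : meyerW ν a b ((2 : ℝ) ^ (-s) * ξ 0) ≠ 0 := by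
    intro h
    cases t <;> simp_all [meyerW2]
  have h9 : |(2 : ℝ) ^ (-s) * ξ 1| ≤ 1 / 4 := by
    by_contra h
    exact h7 (meyerW2_eq_zero_of_coord ν a b t (Or.inr (not_le.1 h)))
  have h10 := (mem_support_meyerW ν a b h8).1
  have hs : (0 : ℝ) < 2 ^ s := by positivity
  have hN : (0 : ℝ) < 2 ^ (2 * (j : ℤ)) := by positivity
  rw [abs_zpow_neg_mul] at h9 h10 h5
  rw [lt_div_iff₀ hs] at h10
  rw [div_le_iff₀ hs] at h9
  rw [lt_div_iff₀ hN] at h5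
  linarith [h5.1]

/-- The same comparison gives |ξ₁| ≤ R < 2^s/16 on the common support, where φ̂ equals 1, so the
product separates. -/
theorem conj_meyerW2_mul_lineApprox_v {j : ℕ} (hj : 64 * R ≤ 2 ^ (2 * (j : ℤ))) (s : ℤ)
    (ξ : Plane) :
    (starRingEnd ℂ) (meyerW2 ν a b .v ((2 : ℝ) ^ (-s) • ξ)) * lineApprox ν a b f j ξ =
      f (ξ 0) * profileProduct ν a b (s - 2 * j) ((2 : ℝ) ^ (-s) * ξ 1) := by
  have e : (2 : ℝ) ^ (s - 2 * (j : ℤ)) * ((2 : ℝ) ^ (-s) * ξ 1) =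
      (2 : ℝ) ^ (-(2 * (j : ℤ))) * ξ 1 := by
    rw [← mul_assoc, ← zpow_add₀ two_ne_zero]
    congr 2
    ring
  simp only [meyerW2, lineApprox, profileProduct, e, map_mul, PiLp.smul_apply, smul_eq_mul]
  by_cases h3 : f (ξ 0) = 0
  · simp [h3]
  by_cases h4 : lineProfile ν a b ((2 : ℝ) ^ (-(2 * (j : ℤ))) * ξ 1) = 0
  · simp only [h4, mul_zero]
  by_cases h8 : meyerW ν a b ((2 : ℝ) ^ (-s) * ξ 1) = 0
  · simp only [h8, map_zero, mul_zero, zero_mul]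
  have h5 := (mem_support_lineProfile ν a b h4).1
  have h6 : |ξ 0| ≤ R := le_of_not_gt fun h => h3 (hR _ h)
  have h9 := (mem_support_meyerW ν a b h8).2
  have hs : (0 : ℝ) < 2 ^ s := by positivity
  have hN : (0 : ℝ) < 2 ^ (2 * (j : ℤ)) := by positivity
  have h10 : |(2 : ℝ) ^ (-s) * ξ 0| ≤ 1 / 16 := by
    rw [abs_zpow_neg_mul] at h9 h5 ⊢
    rw [div_le_iff₀ hs] at h9 ⊢
    rw [lt_div_iff₀ hN] at h5
    linarith
  rw [meyerPhiHat_eq_one ν h10, map_one, one_mul]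
  ring

omit hR in
-- The supports 1/16 < |u| ≤ 1/4 and 1/16 < 2^i |u| ≤ 1/2 meet only for -1 ≤ i ≤ 2.
theorem profileProduct_eq_zero {i : ℤ} (hi : i ∉ Finset.Ioo (-2 : ℤ) 3) (u : ℝ) :
    profileProduct ν a b i u = 0 := by
  by_contra hc
  obtain ⟨h1, h2⟩ := mul_ne_zero_iff.1 hc
  have h3 := mem_support_meyerW ν a b (u := u) fun h => h1 (by rw [h, map_zero])
  have h4 := mem_support_lineProfile ν a b h2
  have hs : (0 : ℝ) < 2 ^ i := by positivity
  rw [abs_mul, abs_of_pos hs] at h4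
  rw [Finset.mem_Ioo, not_and_or, not_lt, not_lt] at hi
  rcases hi with hi | hi
  · have : (2 : ℝ) ^ i ≤ 2 ^ (-2 : ℤ) := zpow_le_zpow_right₀ one_le_two hi
    norm_num at this
    nlinarith [abs_nonneg u]
  · have : (2 : ℝ) ^ (3 : ℤ) ≤ 2 ^ i := zpow_le_zpow_right₀ one_le_two hi
    norm_num at this
    nlinarith [abs_nonneg u]

theorem inner_meyerWavelet_lineApprox_eq_zero (hf : MemLp f 2) {t : WaveletType} (ht : t ≠ .v)
    {j : ℕ} (hj : 64 * R ≤ 2 ^ (2 * (j : ℤ))) (s : ℤ) (k : Fin 2 → ℤ) :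
    inner ℂ (meyerWavelet ν a b ⟨t, s, k⟩)
      (𝓕⁻ ((memLp_lineApprox ν a b hf j).toLp (lineApprox ν a b f j)) : L2Plane) = 0 := by
  rw [inner_meyerWavelet_fourierInv]
  simp_rw [conj_meyerW2_mul_lineApprox_eq_zero ν a b hR ht hj]
  simp

theorem inner_meyerWavelet_lineApprox_v (hf : MemLp f 2)
    {j : ℕ} (hj : 64 * R ≤ 2 ^ (2 * (j : ℤ))) (s : ℤ) (k : Fin 2 → ℤ) :
    inner ℂ (meyerWavelet ν a b ⟨.v, s, k⟩)
      (𝓕⁻ ((memLp_lineApprox ν a b hf j).toLp (lineApprox ν a b f j)) : L2Plane) =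
      𝓕⁻ f (k 0 / 2 ^ s) * profileCoeff ν a b (s - 2 * j) (k 1) := by
  rw [inner_meyerWavelet_fourierInv]
  simp_rw [conj_meyerW2_mul_lineApprox_v ν a b hR hj]
  set i := s - 2 * (j : ℤ)
  have hs : (0 : ℝ) < 2 ^ s := by positivity
  have e1 : profileCoeff ν a b i (k 1) = ((2 : ℝ) ^ s : ℝ)⁻¹ *
      ∫ x : ℝ, Complex.exp (2 * Real.pi * Complex.I * (k 1 * (2 ^ (-s) * x) : ℝ)) *
        profileProduct ν a b i (2 ^ (-s) * x) := by
    rw [Measure.integral_comp_mul_left (fun u => Complex.exp (2 * Real.pi * Complex.I *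
      (k 1 * u : ℝ)) * profileProduct ν a b i u), zpow_neg, inv_inv, abs_of_pos hs,
      Complex.real_smul, ← mul_assoc,
      ← Complex.ofReal_mul, inv_mul_cancel₀ hs.ne', Complex.ofReal_one, one_mul]
    rfl
  rw [e1, mul_left_comm, Real.fourierInv_eq', ← integral_plane_mul, Complex.ofReal_inv]
  congr 1
  refine integral_congr_ae (Eventually.of_forall fun ξ => ?_)
  simp only [smul_eq_mul, RCLike.inner_apply, conj_trivial]
  have hexp : Complex.exp (2 * Real.pi * Complex.I *
      (((2 : ℝ) ^ s)⁻¹ * (k 0 * ξ 0 + k 1 * ξ 1) : ℝ)) =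
      Complex.exp ((2 * Real.pi * (k 0 / 2 ^ s * ξ 0) : ℝ) * Complex.I) *
      Complex.exp (2 * Real.pi * Complex.I * (k 1 * (2 ^ (-s) * ξ 1) : ℝ)) := by
    rw [← Complex.exp_add, zpow_neg]
    congr 1
    push_cast
    ring
  rw [hexp]
  ring

/-- The coefficients factor over the two translation directions. The horizontal sum is a Riemann sum
of mesh 2^{-s}, of size at most C · 2^s; the vertical sum carries the clipping. -/
theorem tsum_small_coeff_lineApprox_le (hf : MemLp f 2) {j : ℕ} (hj1 : 1 ≤ j)
    (hj : 64 * R ≤ 2 ^ (2 * (j : ℤ))) {V β : ℝ} (hβ : 0 ≤ β)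
    (hV : ∀ t, ‖𝓕⁻ f t‖ ≤ 1 / (1 + t ^ 2) * V) {C : ℝ≥0∞}
    (hC : ∀ n : ℕ, n ≠ 0 → ∑' k : ℤ, ENNReal.ofReal (1 / (1 + (k / n : ℝ) ^ 2)) ≤ C * n) :
    ∑' l, ENNReal.ofReal (min ‖inner ℂ (meyerWavelet ν a b l)
      (𝓕⁻ ((memLp_lineApprox ν a b hf j).toLp (lineApprox ν a b f j)) : L2Plane)‖ β ^ 2) ≤
    C * 4 * (∑ i ∈ Finset.Ioo (-2 : ℤ) 3, ∑' k : ℤ, ENNReal.ofReal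
      (V * ‖profileCoeff ν a b i k‖ * min (V * ‖profileCoeff ν a b i k‖) β)) *
      ENNReal.ofReal ((2 ^ j) ^ 2) := by
  have hV0 : 0 ≤ V := by
    have := (norm_nonneg _).trans (hV 0)
    simpa using this
  set B : ℤ → ℤ → ℝ := fun i k => V * ‖profileCoeff ν a b i k‖ with hB
  have hB0 : ∀ i k, 0 ≤ B i k := fun i k => by positivity
  have hz : min 0 β ^ 2 = 0 := by rw [min_eq_left hβ, zero_pow two_ne_zero]
  rw [tsum_meyerIndex]
  simp_rw [inner_meyerWavelet_lineApprox_eq_zero ν a b hR hf (t := .h) (by simp) hj,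
    inner_meyerWavelet_lineApprox_eq_zero ν a b hR hf (t := .d) (by simp) hj,
    inner_meyerWavelet_lineApprox_v ν a b hR hf hj, norm_zero, hz, ENNReal.ofReal_zero, tsum_zero,
    zero_add, add_zero]
  -- Measure the scale relative to 2j; only four relative scales remain.
  rw [← (Equiv.addRight (2 * (j : ℤ))).tsum_eq, tsum_eq_sum (s := Finset.Ioo (-2 : ℤ) 3)]
  swap
  · intro i hi
    have h0 : ∀ k, profileCoeff ν a b i k = 0 := fun k => by
      simp [profileCoeff, profileProduct_eq_zero ν a b hi]
    simp [h0, hz]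
  rw [Finset.mul_sum, Finset.sum_mul]
  refine Finset.sum_le_sum fun i hi => ?_
  rw [Finset.mem_Ioo] at hi
  -- The scale is a natural number because i ≥ -1 and j ≥ 1; i ≤ 2 gives the factor 4 below.
  obtain ⟨n, hn⟩ : ∃ n : ℕ, i + 2 * (j : ℤ) = n := ⟨(i + 2 * j).toNat, by omega⟩
  have hn2 : ((2 : ℝ) ^ n) ≤ 4 * (2 ^ j) ^ 2 := by
    have : (2 : ℝ) ^ n ≤ 2 ^ (2 * j + 2) := pow_le_pow_right₀ one_le_two (by omega)
    calc (2 : ℝ) ^ n ≤ _ := this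
      _ = _ := by ring
  simp only [Equiv.coe_addRight, hn]
  rw [← (finTwoArrowEquiv ℤ).symm.tsum_eq, ENNReal.tsum_prod']
  simp only [finTwoArrowEquiv_symm_apply, Matrix.cons_val_zero, Matrix.cons_val_one, zpow_natCast]
  have hin : (n : ℤ) - 2 * j = i := by omega
  rw [hin]
  calc ∑' (k : ℤ) (l : ℤ), ENNReal.ofReal
        (min ‖𝓕⁻ f (k / 2 ^ n) * profileCoeff ν a b i l‖ β ^ 2)
      ≤ ∑' (k : ℤ) (l : ℤ), ENNReal.ofReal (1 / (1 + (k / (2 ^ n : ℕ) : ℝ) ^ 2)) *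
          ENNReal.ofReal (B i l * min (B i l) β) := by
        refine ENNReal.tsum_le_tsum fun k => ENNReal.tsum_le_tsum fun l => ?_
        rw [← ENNReal.ofReal_mul (by positivity)]
        refine ENNReal.ofReal_le_ofReal (sq_min_mul_le (norm_nonneg _) (by positivity) ?_
          (hB0 i l) hβ ?_)
        · rw [div_le_one (by positivity)]
          linarith [sq_nonneg ((k : ℝ) / (2 ^ n : ℕ))]
        · rw [norm_mul, hB, ← mul_assoc]
          push_cast
          exact mul_le_mul_of_nonneg_right (hV _) (norm_nonneg _)
    _ = (∑' (k : ℤ), ENNReal.ofReal (1 / (1 + (k / (2 ^ n : ℕ) : ℝ) ^ 2))) *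
          ∑' l, ENNReal.ofReal (B i l * min (B i l) β) := by
        simp_rw [ENNReal.tsum_mul_left, ENNReal.tsum_mul_right]
    _ ≤ (C * (2 ^ n : ℕ)) * ∑' l, ENNReal.ofReal (B i l * min (B i l) β) := by
        gcongr
        exact hC _ (by positivity)
    _ ≤ (C * (4 * ENNReal.ofReal ((2 ^ j) ^ 2))) *
          ∑' l, ENNReal.ofReal (B i l * min (B i l) β) := by
        gcongr
        have := ENNReal.ofReal_le_ofReal hn2
        rw [ENNReal.ofReal_mul (by norm_num)] at this
        simpa [ENNReal.ofReal_pow] using this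
    _ = _ := by ring

theorem eventually_tsum_small_coeff_lineApprox_le (hf : MemLp f 2) {V : ℝ}
    (hV : ∀ t, ‖𝓕⁻ f t‖ ≤ 1 / (1 + t ^ 2) * V) {β : ℕ → ℝ} (hβ : ∀ j, 0 < β j)
    (hβ_lim : Tendsto β atTop (𝓝 0)) {ε : ℝ} (hε : 0 < ε) :
    ∀ᶠ j : ℕ in atTop, ∑' l, ENNReal.ofReal (min ‖inner ℂ (meyerWavelet ν a b l)
      (𝓕⁻ ((memLp_lineApprox ν a b hf j).toLp (lineApprox ν a b f j)) : L2Plane)‖ (β j) ^ 2) ≤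
      ENNReal.ofReal ((ε * 2 ^ j) ^ 2) := by
  obtain ⟨C, hCtop, hC⟩ := exists_tsum_riemann_le
  have hV0 : 0 ≤ V := by
    have := (norm_nonneg _).trans (hV 0)
    simpa using this
  have h1 : Tendsto (fun j => ∑ i ∈ Finset.Ioo (-2 : ℤ) 3, ∑' k : ℤ, ENNReal.ofReal
      (V * ‖profileCoeff ν a b i k‖ * min (V * ‖profileCoeff ν a b i k‖) (β j))) atTop
      (𝓝 (∑ i ∈ Finset.Ioo (-2 : ℤ) 3, 0)) := by
    refine tendsto_finsetSum _ fun i _ => tendsto_tsum_mul_min (fun k => by positivity) ?_ hβ hβ_lim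
    simp_rw [mul_pow]
    exact (summable_profileCoeff_sq ν a b i).mul_left _
  have h2 := ENNReal.Tendsto.const_mul (a := C * 4) h1
    (Or.inr (ENNReal.mul_ne_top hCtop (by norm_num)))
  rw [Finset.sum_const_zero, mul_zero] at h2
  have h3 := h2.eventually (gt_mem_nhds (ENNReal.ofReal_pos.2 (pow_pos hε 2)))
  have h4 : Tendsto (fun j : ℕ => (2 : ℝ) ^ (2 * (j : ℤ))) atTop atTop := by
    have : Tendsto (fun j : ℕ => (4 : ℝ) ^ j) atTop atTop :=
      tendsto_pow_atTop_atTop_of_one_lt (by norm_num)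
    refine this.congr fun j => ?_
    rw [zpow_mul]
    norm_num
  filter_upwards [h3, h4.eventually_ge_atTop (64 * R), eventually_ge_atTop 1] with j hj1 hj2 hj3
  refine (tsum_small_coeff_lineApprox_le ν a b hR hf hj3 hj2 (hβ j).le hV hC).trans ?_
  rw [mul_pow, ENNReal.ofReal_mul (by positivity)]
  gcongr

end LineApprox

/-! ### The filter and the filtered line in frequency -/

section FilteredLine

variable (ν : MeyerTransition) (a b : ℝ)

theorem measurable_meyerFilter (j : ℕ) : Measurable (meyerFilter ν a b j) := by
  have h : ∀ t (c : ℝ), Measurable fun ξ : Plane => meyerW2 ν a b t (c • ξ) := fun t c =>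
    (measurable_meyerW2 ν a b t).comp (measurable_const_smul c)
  exact (((h _ _).add (h _ _)).add ((h _ _).add (h _ _))).add ((h _ _).add (h _ _))

theorem norm_meyerFilter_le (j : ℕ) (ξ : Plane) : ‖meyerFilter ν a b j ξ‖ ≤ 6 := by
  have h := fun t (c : ℝ) => norm_meyerW2_le ν a b t (c • ξ)
  have h2 : ∀ t (c d : ℝ), ‖meyerW2 ν a b t (c • ξ) + meyerW2 ν a b t (d • ξ)‖ ≤ 2 :=
    fun t c d => (norm_add_le _ _).trans (by linarith [h t c, h t d])
  refine (norm_add₃_le).trans ?_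
  linarith [h2 .h ((2 : ℝ) ^ (-(2 * (j : ℤ)))) ((2 : ℝ) ^ (-(2 * (j : ℤ)) - 1)),
    h2 .v ((2 : ℝ) ^ (-(2 * (j : ℤ)))) ((2 : ℝ) ^ (-(2 * (j : ℤ)) - 1)),
    h2 .d ((2 : ℝ) ^ (-(2 * (j : ℤ)))) ((2 : ℝ) ^ (-(2 * (j : ℤ)) - 1))]

theorem zpow_sub_one_mul (j : ℕ) (t : ℝ) :
    (2 : ℝ) ^ (-(2 * (j : ℤ)) - 1) * t = 2⁻¹ * ((2 : ℝ) ^ (-(2 * (j : ℤ))) * t) := by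
  rw [zpow_sub_one₀ two_ne_zero]
  ring

theorem meyerFilter_eq_zero {j : ℕ} {ξ : Plane} (h : (2 : ℝ) ^ (2 * (j : ℤ)) / 2 < |ξ 0| ∨
    (2 : ℝ) ^ (2 * (j : ℤ)) / 2 < |ξ 1|) : meyerFilter ν a b j ξ = 0 := by
  have hN : (0 : ℝ) < 2 ^ (2 * (j : ℤ)) := by positivity
  have key : ∀ i : Fin 2, (2 : ℝ) ^ (2 * (j : ℤ)) / 2 < |ξ i| →
      1 / 4 < |(2 : ℝ) ^ (-(2 * (j : ℤ))) * ξ i| ∧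
      1 / 4 < |(2 : ℝ) ^ (-(2 * (j : ℤ)) - 1) * ξ i| := by
    intro i hi
    have : 1 / 2 < |(2 : ℝ) ^ (-(2 * (j : ℤ))) * ξ i| := by
      rw [abs_zpow_neg_mul, lt_div_iff₀ hN]
      linarith
    rw [zpow_sub_one_mul, abs_inv_two_mul]
    constructor <;> linarith
  have h1 : ∀ t, meyerW2 ν a b t ((2 : ℝ) ^ (-(2 * (j : ℤ))) • ξ) = 0 := fun t =>
    meyerW2_eq_zero_of_coord ν a b t (h.imp (fun h => (key 0 h).1) fun h => (key 1 h).1)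
  have h2 : ∀ t, meyerW2 ν a b t ((2 : ℝ) ^ (-(2 * (j : ℤ)) - 1) • ξ) = 0 := fun t =>
    meyerW2_eq_zero_of_coord ν a b t (h.imp (fun h => (key 0 h).2) fun h => (key 1 h).2)
  simp only [meyerFilter, h1, h2, add_zero]

/-- At low horizontal frequency W(ξ₁) vanishes and φ̂(ξ₁) is 1, so only the vertical windows
survive. -/
theorem meyerFilter_eq_lineProfile {j : ℕ} {ξ : Plane}
    (h : |ξ 0| ≤ (2 : ℝ) ^ (2 * (j : ℤ)) / 16) :
    meyerFilter ν a b j ξ = lineProfile ν a b ((2 : ℝ) ^ (-(2 * (j : ℤ))) * ξ 1) := by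
  have hN : (0 : ℝ) < 2 ^ (2 * (j : ℤ)) := by positivity
  have h1 : |(2 : ℝ) ^ (-(2 * (j : ℤ))) * ξ 0| ≤ 1 / 16 := by
    rw [abs_zpow_neg_mul, div_le_iff₀ hN]
    linarith
  have h2 : |2⁻¹ * ((2 : ℝ) ^ (-(2 * (j : ℤ))) * ξ 0)| ≤ 1 / 16 := by
    rw [abs_inv_two_mul]
    linarith [abs_nonneg ((2 : ℝ) ^ (-(2 * (j : ℤ))) * ξ 0)]
  simp only [meyerFilter, meyerW2, PiLp.smul_apply, smul_eq_mul, zpow_sub_one_mul,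
    meyerW_eq_zero_of_abs_le ν a b h1, meyerW_eq_zero_of_abs_le ν a b h2,
    meyerPhiHat_eq_one ν h1, meyerPhiHat_eq_one ν h2, lineProfile]
  ring

theorem memLp_mul_meyerFilter {f : ℝ → ℂ} (hf : Measurable f) {C : ℝ} (hC : ∀ t, ‖f t‖ ≤ C)
    (j : ℕ) (p : ℝ≥0∞) : MemLp (fun ξ : Plane => f (ξ 0) * meyerFilter ν a b j ξ) p := by
  have e0 : Measurable fun ξ : Plane => ξ 0 := Continuous.measurable (by fun_prop)
  refine (memLp_top_of_bound ((hf.comp e0).mul (measurable_meyerFilter ν a b j)).aestronglyMeasurable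
    (C * 6) (Eventually.of_forall fun ξ => ?_)).mono_exponent_of_measure_support_ne_top
      (s := Metric.closedBall (0 : Plane) ((2 : ℝ) ^ (2 * (j : ℤ)))) (fun ξ hξ => ?_)
      measure_closedBall_lt_top.ne le_top
  · rw [Pi.mul_apply, norm_mul]
    exact mul_le_mul (hC _) (norm_meyerFilter_le ν a b j ξ) (norm_nonneg _)
      ((norm_nonneg _).trans (hC 0))
  · rw [mem_closedBall_zero_iff, not_le] at hξ
    have hN : (0 : ℝ) < 2 ^ (2 * (j : ℤ)) := by positivity
    rw [Pi.mul_apply, meyerFilter_eq_zero, mul_zero]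
    by_contra hc
    push Not at hc
    have hn : ‖ξ‖ ^ 2 = |ξ 0| ^ 2 + |ξ 1| ^ 2 := by
      rw [EuclideanSpace.norm_sq_eq]; simp [Fin.sum_univ_two]
    nlinarith [abs_nonneg (ξ 0), abs_nonneg (ξ 1), hc.1, hc.2]

theorem integrable_meyerFilter (j : ℕ) : Integrable (meyerFilter ν a b j) := by
  have h := memLp_mul_meyerFilter ν a b (f := fun _ => 1) measurable_const (C := 1) (by simp) j 1
  simpa [memLp_one_iff_integrable] using h

/-- The Fourier transform of the filtered line singularity is the product of the Fourier transform
of the weight with the filter. -/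
theorem filteredLine_eq_fourierInv {w : ℝ → ℝ} {ρ : ℝ} (hρ : 0 < ρ)
    (hw : Integrable fun t => (w t : ℂ)) (hw_supp : Function.support w ⊆ Set.Icc (-ρ) ρ) (j : ℕ) :
    filteredLine ν a b w ρ j =
      𝓕⁻ fun ξ : Plane => 𝓕 (fun t => (w t : ℂ)) (ξ 0) * meyerFilter ν a b j ξ := by
  ext x
  rw [filteredLine, lineSingularity, intervalIntegral.integral_of_le (by linarith),
    ← integral_Icc_eq_integral_Ioc, setIntegral_eq_integral_of_forall_compl_eq_zero]
  swap
  · intro t ht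
    rw [Function.notMem_support.1 fun h => ht (hw_supp h)]
    simp
  -- The joint kernel for Fubini: its modulus is |w(t)| |F_j(ξ)|, integrable on the product.
  set K : ℝ → Plane → ℂ := fun t ξ => Complex.exp ((2 * Real.pi * (inner ℝ ξ x - ξ 0 * t) : ℝ) *
    Complex.I) * ((w t : ℂ) * meyerFilter ν a b j ξ) with hK
  have hKint : Integrable (Function.uncurry K) (volume.prod volume) := by
    refine (hw.mul_prod (integrable_meyerFilter ν a b j)).bdd_mul (c := 1)
      (Continuous.aestronglyMeasurable (by fun_prop)) (Eventually.of_forall fun p => ?_)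
    rw [Complex.norm_exp_ofReal_mul_I]
  have h1 : ∀ t, (w t : ℂ) * 𝓕⁻ (meyerFilter ν a b j) (x - !₂[t, 0]) = ∫ ξ, K t ξ := by
    intro t
    rw [Real.fourierInv_eq', ← integral_const_mul]
    refine integral_congr_ae (Eventually.of_forall fun ξ => ?_)
    simp only [hK, plane_inner, smul_eq_mul]
    rw [mul_left_comm]
    congr 3
    simp
    ring
  simp_rw [h1]
  rw [integral_integral_swap hKint, Real.fourierInv_eq']
  refine integral_congr_ae (Eventually.of_forall fun ξ => ?_)
  simp only [hK, smul_eq_mul]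
  rw [Real.fourier_eq', ← integral_mul_const, ← integral_const_mul]
  refine integral_congr_ae (Eventually.of_forall fun t => ?_)
  simp only [smul_eq_mul, RCLike.inner_apply, conj_trivial]
  have hexp : Complex.exp ((2 * Real.pi * (inner ℝ ξ x - ξ 0 * t) : ℝ) * Complex.I) =
      Complex.exp ((2 * Real.pi * inner ℝ ξ x : ℝ) * Complex.I) *
      Complex.exp ((-2 * Real.pi * (ξ 0 * t) : ℝ) * Complex.I) := by
    rw [← Complex.exp_add]
    congr 1
    push_cast
    ring
  rw [hexp]
  ring

end FilteredLine

/-! ### The missing strip -/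

section Strip

theorem coeFn_knownPart (h : ℝ) (f : L2Plane) :
    knownPart h f =ᵐ[volume] (maskStrip h)ᶜ.indicator f :=
  MemLp.coeFn_toLp _

theorem coeFn_sub_knownPart (h : ℝ) (f : L2Plane) :
    (f - knownPart h f : L2Plane) =ᵐ[volume] (maskStrip h).indicator f := by
  filter_upwards [Lp.coeFn_sub f (knownPart h f), coeFn_knownPart h f] with x h1 h2
  rw [h1, Pi.sub_apply, h2]
  by_cases hx : x ∈ maskStrip h <;> simp [hx]

/-- Restriction to the strip is a linear contraction, so the loss of f transfers to an approximation
g. -/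
theorem norm_sub_knownPart_le (h : ℝ) (f g : L2Plane) :
    ‖f - knownPart h f‖ ≤ ‖f - g‖ + ‖g - knownPart h g‖ := by
  have h1 : ‖(f - knownPart h f) - (g - knownPart h g)‖ ≤ ‖f - g‖ := by
    refine Lp.norm_le_norm_of_ae_le ?_
    filter_upwards [Lp.coeFn_sub (f - knownPart h f) (g - knownPart h g), Lp.coeFn_sub f g,
      coeFn_sub_knownPart h f, coeFn_sub_knownPart h g] with x e1 e2 e3 e4
    rw [e1, e2, Pi.sub_apply, Pi.sub_apply, e3, e4]
    by_cases hx : x ∈ maskStrip h <;> simp [hx]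
  have h2 := norm_le_norm_sub_add (f - knownPart h f) (g - knownPart h g)
  linarith

theorem norm_toLp_le_of_ae_le {α : Type*} [MeasurableSpace α] {μ : Measure α} {f g : α → ℂ}
    (hf : MemLp f 2 μ) (hg : MemLp g 2 μ) (h : ∀ x, ‖f x‖ ≤ ‖g x‖) :
    ‖hf.toLp f‖ ≤ ‖hg.toLp g‖ := by
  refine Lp.norm_le_norm_of_ae_le ?_
  filter_upwards [hf.coeFn_toLp, hg.coeFn_toLp] with x h1 h2
  rw [h1, h2]
  exact h x

theorem memLp_indicator_Icc_const (c : ℝ) (r : ℝ) :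
    MemLp ((Set.Icc (-r) r).indicator fun _ => (c : ℂ)) 2 (volume : Measure ℝ) :=
  memLp_indicator_const 2 measurableSet_Icc _ (Or.inr measure_Icc_lt_top.ne)

/-- The `L²` norm of a constant on an interval. -/
theorem norm_indicator_Icc_const {c r : ℝ} (hc : 0 ≤ c) (hr : 0 ≤ r) :
    ‖(memLp_indicator_Icc_const c r).toLp _‖ = c * √(2 * r) := by
  have h := ofReal_norm_toLp_sq (memLp_indicator_Icc_const c r)
  have h2 : ∫⁻ x : ℝ, ‖(Set.Icc (-r) r).indicator (fun _ => (c : ℂ)) x‖ₑ ^ 2 =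
      ENNReal.ofReal ((c * √(2 * r)) ^ 2) := by
    have : ∀ x : ℝ, ‖(Set.Icc (-r) r).indicator (fun _ => (c : ℂ)) x‖ₑ ^ 2 =
        (Set.Icc (-r) r).indicator (fun _ => ENNReal.ofReal (c ^ 2)) x := by
      intro x
      by_cases hx : x ∈ Set.Icc (-r) r
      · rw [Set.indicator_of_mem hx, Set.indicator_of_mem hx, ← ofReal_norm, Complex.norm_real,
          Real.norm_of_nonneg hc, ENNReal.ofReal_pow hc]
      · rw [Set.indicator_of_notMem hx, Set.indicator_of_notMem hx]
        simp
    simp_rw [this]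
    rw [lintegral_indicator_const measurableSet_Icc, Real.volume_Icc, ← ENNReal.ofReal_mul
      (by positivity), mul_pow, Real.sq_sqrt (by positivity)]
    congr 2
    ring
  rw [h2, ENNReal.ofReal_eq_ofReal_iff (by positivity) (by positivity)] at h
  exact (sq_eq_sq₀ (norm_nonneg _) (by positivity)).1 h

end Strip

/-! ### Norm estimates for the separable approximation -/

section Estimates

variable (ν : MeyerTransition) (a b : ℝ)

theorem memLp_lineProfile : MemLp (lineProfile ν a b) 2 := by
  simpa using memLp_lineProfile_mul ν a b one_pos 2

theorem sqrt_two_zpow (j : ℕ) : √((2 : ℝ) ^ (2 * (j : ℤ))) = 2 ^ j := by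
  rw [show (2 : ℝ) ^ (2 * (j : ℤ)) = (2 ^ j) ^ 2 by
    rw [← zpow_natCast, ← zpow_natCast, ← zpow_mul]
    congr 1
    push_cast
    ring]
  exact Real.sqrt_sq (by positivity)

theorem norm_lineProfile_dilate (j : ℕ) :
    ‖(memLp_lineProfile_mul ν a b (M := (2 : ℝ) ^ (-(2 * (j : ℤ)))) (by positivity) 2).toLp _‖ =
      2 ^ j * ‖(memLp_lineProfile ν a b).toLp _‖ := by
  have hN : (0 : ℝ) < 2 ^ (2 * (j : ℤ)) := by positivity
  have hM : (0 : ℝ) < 2 ^ (-(2 * (j : ℤ))) := by positivity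
  have hc : |((2 : ℝ) ^ (-(2 * (j : ℤ))))⁻¹| = 2 ^ (2 * (j : ℤ)) := by
    rw [zpow_neg, inv_inv, abs_of_pos hN]
  have h1 := ofReal_norm_toLp_sq (memLp_lineProfile_mul ν a b hM 2)
  have h2 : ∫⁻ u, ‖lineProfile ν a b ((2 : ℝ) ^ (-(2 * (j : ℤ))) * u)‖ₑ ^ 2 =
      ∫⁻ u, ‖lineProfile ν a b u‖ₑ ^ 2 ∂(Measure.map ((2 : ℝ) ^ (-(2 * (j : ℤ))) * ·) volume) :=
    (lintegral_map ((measurable_lineProfile ν a b).enorm.pow_const 2)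
      (measurable_const_mul _)).symm
  rw [h2, Real.map_volume_mul_left hM.ne', lintegral_smul_measure,
    ← ofReal_norm_toLp_sq (memLp_lineProfile ν a b), hc, smul_eq_mul,
    ← ENNReal.ofReal_mul hN.le, ENNReal.ofReal_eq_ofReal_iff (by positivity) (by positivity),
    ← Real.sq_sqrt hN.le, sqrt_two_zpow, ← mul_pow] at h1
  exact (sq_eq_sq₀ (norm_nonneg _) (by positivity)).1 h1

theorem norm_lineProfile_pos : 0 < ‖(memLp_lineProfile ν a b).toLp _‖ := by
  rw [norm_pos_iff]
  intro h0
  have h1 : lineProfile ν a b =ᵐ[volume] 0 := by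
    have := (memLp_lineProfile ν a b).coeFn_toLp
    rw [h0] at this
    exact this.symm.trans (Lp.coeFn_zero _ _ _)
  have hν : Continuous ν.toFun := ν.smooth.continuous
  set U : Set ℝ := Set.Ioo (1 / 16) (1 / 8) ∩
    {u | Real.sin (Real.pi / 2 * ν.toFun (16 * u - 1)) ≠ 0} with hU
  have hUo : IsOpen U := isOpen_Ioo.inter (isOpen_ne_fun (by fun_prop) continuous_const)
  -- At the midpoint of the inner band the argument of ν is 1/2, where the reflection identity
  -- forces ν = 1/2 and the sine is sin(π/4).
  have hUne : (3 / 32 : ℝ) ∈ U := by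
    refine ⟨by constructor <;> norm_num, ?_⟩
    have e1 := ν.add_reflect (1 / 2)
    norm_num at e1
    have e2 : ν.toFun (16 * (3 / 32) - 1) = 1 / 2 := by
      norm_num
      linarith
    rw [Set.mem_ofPred_eq, e2, show Real.pi / 2 * (1 / 2) = Real.pi / 4 by ring, Real.sin_pi_div_four]
    positivity
  have hpos := hUo.measure_pos volume ⟨_, hUne⟩
  refine hpos.ne' (measure_mono_null (fun u hu => ?_) h1)
  obtain ⟨⟨hu1, hu2⟩, hu3⟩ := hu
  have hu0 : |u| = u := abs_of_pos (by linarith)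
  simp only [Set.mem_compl_iff, Set.mem_ofPred_eq, Pi.zero_apply]
  rw [lineProfile, meyerW_eq_zero_of_abs_le ν a b (t := 2⁻¹ * u)
    (by rw [abs_inv_two_mul, hu0]; linarith), add_zero]
  unfold meyerW
  rw [if_pos (by rw [hu0]; constructor <;> linarith), hu0]
  exact mul_ne_zero (Complex.exp_ne_zero _) (by exact_mod_cast hu3)

theorem norm_lineApprox {f : ℝ → ℂ} (hf : MemLp f 2) (j : ℕ) :
    ‖(memLp_lineApprox ν a b hf j).toLp _‖ =
      ‖hf.toLp f‖ * (2 ^ j * ‖(memLp_lineProfile ν a b).toLp _‖) := by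
  rw [← norm_lineProfile_dilate]
  exact norm_toLp_plane_mul hf (memLp_lineProfile_mul ν a b (by positivity) 2)

/-- Where g lives, the filter is already the profile, so the difference is exactly (f - g)F_j. The
filter is bounded by 6 and vanishes for |ξ₂| > 2^{2j}/2; the constant 6 on that band has L² norm 6 ·
2^j. -/
theorem norm_filter_sub_lineApprox_le {f g : ℝ → ℂ} (hf : MemLp f 2) (hg : MemLp g 2) {R : ℝ}
    (hR : ∀ t, R < |t| → g t = 0) {j : ℕ} (hj : 16 * R ≤ 2 ^ (2 * (j : ℤ)))
    (hX : MemLp (fun ξ : Plane => f (ξ 0) * meyerFilter ν a b j ξ) 2 volume) :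
    ‖hX.toLp _ - (memLp_lineApprox ν a b hg j).toLp _‖ ≤
      ‖(hf.sub hg).toLp (f - g)‖ * (6 * 2 ^ j) := by
  have hN : (0 : ℝ) < 2 ^ (2 * (j : ℤ)) := by positivity
  set r : ℝ := 2 ^ (2 * (j : ℤ)) / 2 with hr
  have e : (6 : ℝ) * 2 ^ j = ‖(memLp_indicator_Icc_const 6 r).toLp _‖ := by
    rw [norm_indicator_Icc_const (by norm_num) (by positivity), hr, mul_div_cancel₀ _ two_ne_zero,
      sqrt_two_zpow]
  have e3 := norm_toLp_plane_mul (hf.sub hg) (memLp_indicator_Icc_const 6 r)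
  rw [e, ← e3, ← MemLp.toLp_sub]
  refine norm_toLp_le_of_ae_le _ _ fun ξ => ?_
  have h1 : f (ξ 0) * meyerFilter ν a b j ξ - lineApprox ν a b g j ξ =
      (f (ξ 0) - g (ξ 0)) * meyerFilter ν a b j ξ := by
    rw [lineApprox, sub_mul]
    by_cases h : R < |ξ 0|
    · simp [hR _ h]
    · rw [meyerFilter_eq_lineProfile ν a b (by linarith)]
  rw [Pi.sub_apply, h1, Pi.sub_apply, norm_mul, norm_mul]
  refine mul_le_mul_of_nonneg_left ?_ (norm_nonneg _)
  by_cases hξ : ξ 1 ∈ Set.Icc (-r) r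
  · rw [Set.indicator_of_mem hξ]
    simpa using norm_meyerFilter_le ν a b j ξ
  · rw [meyerFilter_eq_zero, norm_zero]
    · exact norm_nonneg _
    · right
      rw [Set.mem_Icc, ← abs_le, not_le] at hξ
      exact hξ

/-- In space y is a product, and the strip constrains the first coordinate only. Bounding the first
factor by V on [-h, h] gives V√(2h), and Plancherel computes the norm of the second. -/
theorem norm_strip_lineApprox_le {f : ℝ → ℂ} (hf1 : Integrable f) (hf : MemLp f 2) {V : ℝ}
    (hV : ∀ t, ‖𝓕⁻ f t‖ ≤ V) {h : ℝ} (hh : 0 ≤ h) (j : ℕ) {y : L2Plane}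
    (hy : y = 𝓕⁻ ((memLp_lineApprox ν a b hf j).toLp (lineApprox ν a b f j))) :
    ‖y - knownPart h y‖ ≤
      V * √(2 * h) * (2 ^ j * ‖(memLp_lineProfile ν a b).toLp _‖) := by
  have hV0 : 0 ≤ V := (norm_nonneg _).trans (hV 0)
  have hM : (0 : ℝ) < 2 ^ (-(2 * (j : ℤ))) := by positivity
  have hp1 := memLp_one_iff_integrable.1 (memLp_lineProfile_mul ν a b hM 1)
  have hp2 := memLp_lineProfile_mul ν a b hM 2
  set p : ℝ → ℂ := fun u => lineProfile ν a b ((2 : ℝ) ^ (-(2 * (j : ℤ))) * u) with hp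
  have e1 : ‖(memLp_fourierInv hp1 hp2).toLp _‖ =
      2 ^ j * ‖(memLp_lineProfile ν a b).toLp _‖ := by
    rw [toLp_fourierInv hp1 hp2, norm_fourierInv_L2]
    exact norm_lineProfile_dilate ν a b j
  rw [← norm_indicator_Icc_const hV0 hh, ← e1,
    ← norm_toLp_plane_mul (memLp_indicator_Icc_const V h) (memLp_fourierInv hp1 hp2)]
  refine Lp.norm_le_norm_of_ae_le ?_
  have e2 : y =ᵐ[volume] fun x : Plane => 𝓕⁻ f (x 0) * 𝓕⁻ p (x 1) := by
    rw [hy]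
    refine (coeFn_fourierInv_toLp (integrable_plane_mul hf1 hp1) _).trans (Eventually.of_forall ?_)
    exact fourierInv_plane_mul f p
  filter_upwards [coeFn_sub_knownPart h y, e2, MemLp.coeFn_toLp (memLp_plane_mul
    (memLp_indicator_Icc_const V h) (memLp_fourierInv hp1 hp2))] with x h1 h2 h3
  rw [h1, h3, norm_mul]
  by_cases hx : x ∈ maskStrip h
  · rw [Set.indicator_of_mem hx, h2, norm_mul, Set.indicator_of_mem (show x 0 ∈ Set.Icc (-h) h from abs_le.1 hx),
      Complex.norm_real, Real.norm_of_nonneg hV0]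
    exact mul_le_mul_of_nonneg_right (hV _) (norm_nonneg _)
  · rw [Set.indicator_of_notMem hx, norm_zero]
    positivity

/-- Schwartz functions on the line decay faster than `1 / (1 + t²)`. -/
theorem SchwartzMap.exists_norm_le_one_div (v : SchwartzMap ℝ ℂ) :
    ∃ V : ℝ, ∀ t, ‖v t‖ ≤ 1 / (1 + t ^ 2) * V := by
  obtain ⟨C0, -, h0⟩ := v.decay 0 0
  obtain ⟨C2, -, h2⟩ := v.decay 2 0
  refine ⟨C0 + C2, fun t => ?_⟩
  have e0 := h0 t
  have e2 := h2 t
  rw [norm_iteratedFDeriv_zero, Real.norm_eq_abs] at e0 e2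
  rw [sq_abs] at e2
  rw [one_div, ← div_eq_inv_mul, le_div_iff₀ (by positivity)]
  linarith

end Estimates

theorem IsParsevalFrame.norm_sub_le_of_isPartialReconstruction {H : Type*} [NormedAddCommGroup H]
    [InnerProductSpace ℂ H] [CompleteSpace H] {I : Type*} {Φ : I → H} (hΦ : IsParsevalFrame Φ)
    {x f y z L : H} {β m : ℝ} (hβ : 0 ≤ β) (hm : 0 ≤ m) (hz : ‖z - x‖ ≤ ‖x - f‖)
    (hsum : ∑' i, ENNReal.ofReal (min ‖inner ℂ (Φ i) y‖ β ^ 2) ≤ ENNReal.ofReal (m ^ 2))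
    (hL : IsPartialReconstruction Φ (thresholdSet Φ f β) z L) :
    ‖L - x‖ ≤ 5 * ‖x - f‖ + 2 * ‖x - y‖ + 2 * m := by
  obtain ⟨L', h1, h2⟩ := hΦ.norm_reconstruction_sub_le hβ hm hz hsum
  rwa [HasSum.unique hL h1]

/-- A square integrable function on the line is approximated in `L²` by smooth functions of compact
support. -/
theorem exists_schwartz_approx {f : ℝ → ℂ} (hf : MemLp f 2) {δ : ℝ} (hδ : 0 < δ) :
    ∃ (g : SchwartzMap ℝ ℂ) (R : ℝ) (hg : MemLp g 2 volume), (∀ t, R < |t| → g t = 0) ∧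
      ‖(hf.sub hg).toLp (f - (g : ℝ → ℂ))‖ ≤ δ := by
  obtain ⟨g, hg1, hg2, hg3⟩ := hf.exist_eLpNorm_sub_le (by norm_num) (by norm_num) hδ
  obtain ⟨R, hR⟩ := hg1.isCompact.isBounded.subset_closedBall 0
  refine ⟨hg1.toSchwartzMap hg2, R, (hg1.toSchwartzMap hg2).memLp 2 volume, fun t ht => ?_, ?_⟩
  · refine image_eq_zero_of_notMem_tsupport fun hc => ?_
    have := hR hc
    rw [mem_closedBall_zero_iff, Real.norm_eq_abs] at this
    linarith
  · rw [Lp.norm_toLp]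
    exact ENNReal.toReal_le_of_le_ofReal hδ.le hg3

/-! ### Approximation and relative error -/

section Assembly

variable (ν : MeyerTransition) (a b : ℝ)

theorem tendsto_four_zpow_atTop : Tendsto (fun j : ℕ => (2 : ℝ) ^ (2 * (j : ℤ))) atTop atTop := by
  have : Tendsto (fun j : ℕ => (4 : ℝ) ^ j) atTop atTop :=
    tendsto_pow_atTop_atTop_of_one_lt (by norm_num)
  refine this.congr fun j => ?_
  rw [zpow_mul]
  norm_num

theorem tendsto_zero_of_isLittleO_zpow {h : ℕ → ℝ}
    (hh : h =o[atTop] fun j : ℕ => (2 : ℝ) ^ (-(2 * (j : ℤ)))) : Tendsto h atTop (𝓝 0) := by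
  refine hh.isBigO.trans_tendsto ?_
  simp_rw [zpow_neg]
  exact tendsto_inv_atTop_zero.comp tendsto_four_zpow_atTop

variable {ν a b}

/-- For images whose Fourier transforms are `f (ξ₁) F_j (ξ)`, there are approximations with few
small Meyer coefficients and little energy in the strips. -/
theorem exists_approximation {f : ℝ → ℂ} (hf : MemLp f 2)
    (hX : ∀ j : ℕ, MemLp (fun ξ : Plane => f (ξ 0) * meyerFilter ν a b j ξ) 2 volume)
    {h : ℕ → ℝ} (hh : ∀ j, 0 ≤ h j) (hh_lim : Tendsto h atTop (𝓝 0))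
    {β : ℕ → ℝ} (hβ : ∀ j, 0 < β j) (hβ_lim : Tendsto β atTop (𝓝 0)) {ε : ℝ} (hε : 0 < ε) :
    ∃ y : ℕ → L2Plane, ∀ᶠ j : ℕ in atTop,
      ‖(𝓕⁻ ((hX j).toLp _) : L2Plane) - y j‖ ≤ ε * 2 ^ j ∧
      ‖y j - knownPart (h j) (y j)‖ ≤ ε * 2 ^ j ∧
      (‖hf.toLp f‖ * ‖(memLp_lineProfile ν a b).toLp _‖ - ε) * 2 ^ j ≤ ‖y j‖ ∧
      ∑' l, ENNReal.ofReal (min ‖inner ℂ (meyerWavelet ν a b l) (y j)‖ (β j) ^ 2) ≤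
        ENNReal.ofReal ((ε * 2 ^ j) ^ 2) := by
  set G := ‖(memLp_lineProfile ν a b).toLp _‖ with hG
  have hG0 : 0 ≤ G := norm_nonneg _
  -- The first bound controls the filter error 6δ, the second the loss δG in the lower bound on
  -- ‖y_j‖; G + 1 avoids division by zero.
  set δ : ℝ := min (ε / 6) (ε / (G + 1)) with hδ
  have hδ0 : 0 < δ := lt_min (by positivity) (by positivity)
  have hδ1 : δ * 6 ≤ ε := (le_div_iff₀ (by norm_num)).1 (min_le_left _ _)
  have hδ2 : δ * G ≤ ε := by
    have := (le_div_iff₀ (by positivity)).1 (min_le_right (ε / 6) (ε / (G + 1)))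
    nlinarith
  obtain ⟨g, R, hg, hR, hgf⟩ := exists_schwartz_approx hf hδ0
  obtain ⟨V, hV⟩ := SchwartzMap.exists_norm_le_one_div (𝓕⁻ g)
  rw [SchwartzMap.fourierInv_coe] at hV
  have hV0 : 0 ≤ V := by
    have := (norm_nonneg _).trans (hV 0)
    simpa using this
  have hV1 : ∀ t, ‖𝓕⁻ (g : ℝ → ℂ) t‖ ≤ V := fun t => (hV t).trans <|
    mul_le_of_le_one_left hV0 (by
      rw [div_le_one (by positivity)]
      linarith [sq_nonneg t])
  refine ⟨fun j => 𝓕⁻ ((memLp_lineApprox ν a b hg j).toLp (lineApprox ν a b g j)), ?_⟩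
  have hstrip : Tendsto (fun j => V * √(2 * h j) * G) atTop (𝓝 0) := by
    have h1 := ((hh_lim.const_mul 2).sqrt.const_mul V).mul_const G
    simpa using h1
  filter_upwards [tendsto_four_zpow_atTop.eventually_ge_atTop (16 * R),
    hstrip.eventually (gt_mem_nhds hε),
    eventually_tsum_small_coeff_lineApprox_le ν a b hR hg hV hβ hβ_lim hε] with j hj1 hj2 hj3
  have hp : (0 : ℝ) < 2 ^ j := by positivity
  refine ⟨?_, ?_, ?_, hj3⟩
  · have e : (𝓕⁻ ((hX j).toLp _) : L2Plane) -
        𝓕⁻ ((memLp_lineApprox ν a b hg j).toLp (lineApprox ν a b g j)) =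
        𝓕⁻ ((hX j).toLp _ - (memLp_lineApprox ν a b hg j).toLp (lineApprox ν a b g j)) :=
      ((Lp.fourierTransformₗᵢ Plane ℂ).symm.map_sub _ _).symm
    rw [e, norm_fourierInv_L2]
    refine (norm_filter_sub_lineApprox_le ν a b hf hg hR hj1 (hX j)).trans ?_
    calc _ ≤ δ * (6 * 2 ^ j) := by gcongr
      _ = (δ * 6) * 2 ^ j := by ring
      _ ≤ _ := by gcongr
  · refine (norm_strip_lineApprox_le ν a b g.integrable hg hV1 (hh j) j rfl).trans ?_
    calc _ = (V * √(2 * h j) * G) * 2 ^ j := by rw [hG]; ring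
      _ ≤ _ := by gcongr
  · rw [norm_fourierInv_L2, norm_lineApprox ν a b hg j, ← hG]
    have e1 : ‖hf.toLp f‖ ≤ ‖hg.toLp g‖ + δ := by
      rw [MemLp.toLp_sub hf hg] at hgf
      have := norm_sub_norm_le (hf.toLp f) (hg.toLp g)
      linarith
    calc _ ≤ (‖hg.toLp g‖ * G) * 2 ^ j := by
          gcongr
          nlinarith
      _ = _ := by ring

/-- One-step hard thresholding reconstructs a sequence of images of size at least `2 ^ j` with
vanishing relative error if there are approximations as in `exists_approximation`. -/
theorem tendsto_relative_error {x : ℕ → L2Plane} {h β : ℕ → ℝ} (hβ : ∀ j, 0 < β j)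
    {c : ℝ} (hc : 0 < c) (hx : ∀ᶠ j : ℕ in atTop, c * 2 ^ j ≤ ‖x j‖)
    (happ : ∀ ε : ℝ, 0 < ε → ∃ y : ℕ → L2Plane, ∀ᶠ j : ℕ in atTop, ‖x j - y j‖ ≤ ε * 2 ^ j ∧
      ‖y j - knownPart (h j) (y j)‖ ≤ ε * 2 ^ j ∧
      ∑' l, ENNReal.ofReal (min ‖inner ℂ (meyerWavelet ν a b l) (y j)‖ (β j) ^ 2) ≤
        ENNReal.ofReal ((ε * 2 ^ j) ^ 2))
    {z : ℕ → L2Plane} (hz : ∀ j, ‖z j - x j‖ ≤ ‖x j - knownPart (h j) (x j)‖) {L : ℕ → L2Plane}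
    (hL : ∀ j, IsPartialReconstruction (meyerWavelet ν a b)
      (thresholdSet (meyerWavelet ν a b) (knownPart (h j) (x j)) (β j)) (z j) (L j)) :
    Tendsto (fun j => ‖L j - x j‖ / ‖x j‖) atTop (𝓝 0) := by
  refine squeeze_zero' (Eventually.of_forall fun j => by positivity)
    (g := fun j => ‖L j - x j‖ / (c * 2 ^ j)) ?_ ?_
  · filter_upwards [hx] with j hj
    gcongr
  rw [Metric.tendsto_atTop']
  intro ε hε
  -- Here ‖x - f‖ ≤ 2η 2^j, so the thresholding bound gives 5 · 2 + 2 + 2 = 14 multiples of η 2^j;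
  -- 15 makes the inequality strict.
  set η : ℝ := ε * c / 15 with hη
  have hη0 : 0 < η := by positivity
  obtain ⟨y, hy⟩ := happ η hη0
  obtain ⟨n, hn⟩ := eventually_atTop.1 hy
  refine ⟨n, fun j hj => ?_⟩
  obtain ⟨h1, h2, h3⟩ := hn j hj.le
  have hp : (0 : ℝ) < 2 ^ j := by positivity
  have h4 := (isParsevalFrame_meyerWavelet ν a b).norm_sub_le_of_isPartialReconstruction (hβ j).le
    (by positivity) (hz j) h3 (hL j)
  have h5 := norm_sub_knownPart_le (h j) (x j) (y j)
  rw [Real.dist_0_eq_abs, abs_of_nonneg (by positivity), div_lt_iff₀ (by positivity)]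
  have h6 : ‖L j - x j‖ ≤ 14 * (η * 2 ^ j) := by linarith
  refine h6.trans_lt ?_
  have : ε * (c * 2 ^ j) = 15 * (η * 2 ^ j) := by
    rw [hη]
    ring
  rw [this]
  linarith [mul_pos hη0 hp]

end Assembly

end

/-! ### The main theorem -/

theorem mainTheorem4
    (ν : MeyerTransition) (a b : ℝ)
    (ρ : ℝ) (hρ : 0 < ρ)
    (w : ℝ → ℝ) (hw_smooth : ContDiff ℝ ∞ w) (hw_range : ∀ t, w t ∈ Set.Icc (0 : ℝ) 1)
    (hw_supp : Function.support w ⊆ Set.Icc (-ρ) ρ) (hw_ne : ∃ t, w t ≠ 0)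
    (h : ℕ → ℝ) (hh : ∀ j, 0 ≤ h j)
    (hh_small : h =o[atTop] fun j : ℕ => (2 : ℝ) ^ (-(2 * (j : ℤ))))
    (β : ℕ → ℝ) (hβ : ∀ j, 0 < β j) (hβ_lim : Tendsto β atTop (𝓝 0)) :
    ∃ hL2 : ∀ j, MemLp (filteredLine ν a b w ρ j) 2 (volume : Measure Plane),
    ∃ x : ℕ → L2Plane, (∀ j, x j = (hL2 j).toLp (filteredLine ν a b w ρ j)) ∧
      (∀ᶠ j in atTop, 0 < ‖x j‖) ∧
      -- reconstruction from the incomplete data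
      (∃ L : ℕ → L2Plane,
        (∀ j, IsPartialReconstruction (meyerWavelet ν a b)
          (thresholdSet (meyerWavelet ν a b) (knownPart (h j) (x j)) (β j))
          (knownPart (h j) (x j)) (L j)) ∧
        Tendsto (fun j => ‖L j - x j‖ / ‖x j‖) atTop (𝓝 0)) ∧
      -- the same thresholding set, applied to the coefficients of the complete image
      (∃ L : ℕ → L2Plane,
        (∀ j, IsPartialReconstruction (meyerWavelet ν a b)
          (thresholdSet (meyerWavelet ν a b) (knownPart (h j) (x j)) (β j))
          (x j) (L j)) ∧
        Tendsto (fun j => ‖L j - x j‖ / ‖x j‖) atTop (𝓝 0)) := by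
  have hwc : HasCompactSupport (Complex.ofRealCLM ∘ w) :=
    (HasCompactSupport.of_support_subset_isCompact isCompact_Icc hw_supp).comp_left rfl
  have hws : ContDiff ℝ ∞ (Complex.ofRealCLM ∘ w) := by fun_prop
  set W : SchwartzMap ℝ ℂ := hwc.toSchwartzMap hws with hW
  have hWw : (W : ℝ → ℂ) = fun t => (w t : ℂ) := rfl
  set f : SchwartzMap ℝ ℂ := 𝓕 W with hf
  have hfw : (f : ℝ → ℂ) = 𝓕 fun t => (w t : ℂ) := by rw [hf, SchwartzMap.fourier_coe, hWw]
  have hf2 : MemLp f 2 volume := f.memLp 2 volume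
  obtain ⟨C, -, hC⟩ := f.decay 0 0
  have hC' : ∀ t, ‖f t‖ ≤ C := fun t => by simpa using hC t
  have hX : ∀ (p : ℝ≥0∞) (j : ℕ),
      MemLp (fun ξ : Plane => f (ξ 0) * meyerFilter ν a b j ξ) p volume := fun p j =>
    memLp_mul_meyerFilter ν a b f.continuous.measurable hC' j p
  have hX1 := fun j => memLp_one_iff_integrable.1 (hX 1 j)
  have hline : ∀ j, filteredLine ν a b w ρ j =
      𝓕⁻ fun ξ : Plane => f (ξ 0) * meyerFilter ν a b j ξ := fun j => by
    rw [hfw, filteredLine_eq_fourierInv ν a b hρ (hWw ▸ W.integrable) hw_supp j]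
  have hL2 : ∀ j, MemLp (filteredLine ν a b w ρ j) 2 (volume : Measure Plane) := fun j => by
    rw [hline j]
    exact memLp_fourierInv (hX1 j) (hX 2 j)
  have hx : ∀ j, (hL2 j).toLp (filteredLine ν a b w ρ j) = 𝓕⁻ ((hX 2 j).toLp _) := fun j => by
    rw [← toLp_fourierInv (hX1 j) (hX 2 j)]
    exact MemLp.toLp_congr _ _ (by rw [hline j])
  have happ := fun ε hε => exists_approximation (ν := ν) (a := a) (b := b) hf2 (hX 2) hh
    (tendsto_zero_of_isLittleO_zpow hh_small) hβ hβ_lim (ε := ε) hε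
  -- By Plancherel ŵ has the norm of w, and a nonzero continuous function is nonzero in L².
  have hA : 0 < ‖hf2.toLp f‖ := by
    have e : ‖hf2.toLp f‖ = ‖W.toLp 2 volume‖ := SchwartzMap.norm_fourier_toL2_eq W
    rw [e, norm_pos_iff]
    intro h0
    obtain ⟨t, ht⟩ := hw_ne
    have h1 : W = 0 := SchwartzMap.injective_toLp (F := ℂ) 2 volume
      (h0.trans (SchwartzMap.toLpCLM ℂ ℂ 2 (volume : Measure ℝ)).map_zero.symm)
    have h2 : W t = 0 := by rw [h1]; rfl
    exact ht (by simpa [hWw] using h2)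
  set c : ℝ := ‖hf2.toLp f‖ * ‖(memLp_lineProfile ν a b).toLp _‖ with hc
  have hc0 : 0 < c := mul_pos hA (norm_lineProfile_pos ν a b)
  have hlow : ∀ᶠ j : ℕ in atTop, c / 2 * 2 ^ j ≤ ‖(hL2 j).toLp (filteredLine ν a b w ρ j)‖ := by
    -- With error c/4, ‖y_j‖ is at least (3c/4) 2^j, which leaves (c/2) 2^j for the image.
    obtain ⟨y, hy⟩ := happ (c / 4) (by positivity)
    filter_upwards [hy] with j hj
    rw [hx j]
    have := norm_sub_norm_le (y j) (𝓕⁻ ((hX 2 j).toLp _))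
    rw [norm_sub_rev] at this
    linarith [hj.1, hj.2.2.1]
  have happ' : ∀ ε : ℝ, 0 < ε → ∃ y : ℕ → L2Plane, ∀ᶠ j : ℕ in atTop,
      ‖(hL2 j).toLp (filteredLine ν a b w ρ j) - y j‖ ≤ ε * 2 ^ j ∧
      ‖y j - knownPart (h j) (y j)‖ ≤ ε * 2 ^ j ∧
      ∑' l, ENNReal.ofReal (min ‖inner ℂ (meyerWavelet ν a b l) (y j)‖ (β j) ^ 2) ≤
        ENNReal.ofReal ((ε * 2 ^ j) ^ 2) := by
    intro ε hε
    obtain ⟨y, hy⟩ := happ ε hε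
    refine ⟨y, hy.mono fun j hj => ⟨?_, hj.2.1, hj.2.2.2⟩⟩
    rw [hx j]
    exact hj.1
  have hframe := isParsevalFrame_meyerWavelet ν a b
  refine ⟨hL2, fun j => (hL2 j).toLp _, fun j => rfl, ?_, ?_, ?_⟩
  · filter_upwards [hlow] with j hj
    exact lt_of_lt_of_le (by positivity) hj
  · exact ⟨_, fun j => hframe.isPartialReconstruction _ _, tendsto_relative_error hβ
      (half_pos hc0) hlow happ' (fun j => (norm_sub_rev _ _).le)
      fun j => hframe.isPartialReconstruction _ _⟩
  · exact ⟨_, fun j => hframe.isPartialReconstruction _ _, tendsto_relative_error hβ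
      (half_pos hc0) hlow happ' (fun j => by simp)
      fun j => hframe.isPartialReconstruction _ _⟩
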